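/- Let $H$ be a finite-dimensional complex Hilbert space and let $V\in\mathcal L(H\otimes H)$ be a unital multiplicative partial isometry (MPI). That is, $VV^*V=V$, and on $H\otimes H\otimes H$ $$V_{23}V_{12}=V_{12}V_{13}V_{23},\quad V_{13}V_{23}V_{23}^*=V_{12}^*V_{12}V_{13},\quad V_{12}V_{12}^*V_{23}=V_{23}V_{12}V_{12}^*,\quad V_{12}V_{23}^*V_{23}=V_{23}^*V_{23}V_{12},$$ and there are linear functionals $\varepsilon,\hat\varepsilon$ on $\mathcal L(H)$ such that $1:=\lambda(\hat\varepsilon)$ and $\hat 1:=\rho(\varepsilon)$ are two-sided units of the right leg $A=\{\lambda(\omega)\}$ and the left leg $\hat A=\{\rho(\omega)\}$, where $\lambda(\omega)=(\omega\otimes\mathrm{id})(V)$ and $\rho(\omega)=(\mathrm{id}\otimes\omega)(V)$. *Relative tensor products.* Let $B$ be a finite-dimensional C*-algebra with a faithful positive functional $\psi$, let $\{a_i\}$ be a basis of $B$ and $\{b_i\}$ the dual basis, $\psi(b_ia_j)=\delta_{ij}$, let $l=\sum_i a_ib_i$ be the index of $\psi$, and let $\theta_\psi$ be the modular automorphism,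 $\psi(xy)=\psi(y\theta_\psi(x))$. It is implemented by a positive invertible $g\in B$, and $\theta_\psi^{1/2}(x)=g^{1/2}xg^{-1/2}$. Put $e_\psi=\sum_i l^{-1}a_i\otimes\theta_\psi^{1/2}(b_i)\in B^o\otimes B$. For *-homomorphisms $\beta:B^o\to\mathcal L(H)$ and $\gamma:B\to\mathcal L(K)$, the relative tensor product $H_\beta\otimes_\psi{}_\gamma K$ is the range of the projection $(\beta\otimes\gamma)(e_\psi)$ in $H\otimes K$. Replacing $(B,\psi)$ by $(B^o,\psi^o)$ gives $\otimes_{\psi^o}$. *Claim.* The set $A^L=\{(\omega\otimes\mathrm{id})(VV^*)\}$ is a *-subalgebra of $\mathcal L(H)$ contained in $A$, with unit $1=\hat 1$, and $\varepsilon|_{A^L}$ is faithful and positive, with index $1$. Let $\theta$ be the modular automorphism of $\varepsilon|_{A^L}$, let $S(x)=(\mathrm{id}\otimes\varepsilon)((\mathbf 1\otimes x)VV^*)$ for $x\in A^L$, and let $S_o=S\circ\theta^{-1/2}$. Then $$\alpha_{01}(x)=x,\qquad \alpha_{02}(x)=S_o(x),\qquad \alpha_{12}(x)=(\mathrm{id}\otimes\omega)(V^*V)\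 \text{ for any }\omega\text{ with }\lambda(\omega)=x$$ are well defined, injective and mutually commuting; $\alpha_{01},\alpha_{12}$ are *-homomorphisms $A^L\to\mathcal L(H)$ and $\alpha_{02}$ is a *-antihomomorphism, and all three send $1$ to $1$. Moreover $$V^*V(H\otimes H)=H_{\alpha_{12}}\otimes_{\varepsilon^o}{}_{\alpha_{02}}H,\qquad VV^*(H\otimes H)=H_{\alpha_{02}}\otimes_{\varepsilon}{}_{\alpha_{01}}H,$$ the projections defining the two relative tensor products being $\hat E=V^*V$ and $E=VV^*$. The restriction of $V$ is a unitary $U:\hat E(H\otimes H)\to E(H\otimes H)$, and it is a pseudo-multiplicative unitary over $(A^L,\varepsilon)$. That is, for $x\in A^L$ it intertwines the four commuting actions (which leave its source and target invariant), $$U(\alpha_{01}(x)\otimes\mathbf 1)=(\alpha_{01}(x)\otimes\mathbf 1)U,\quad U(\mathbf 1\otimes\alpha_{01}(x))=(\alpha_{12}(x)\otimes\mathbf 1)U,$$ $$U(\mathbf 1\otimes\alpha_{12}(x))=(\mathbf 1\otimes\alpha_{12}(x))U,\quad U(\alpha_{02}(x)\otimes\mathbf 1)=(\mathbf 1\otimes\alpha_{02}(x))U,$$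 and it satisfies the Enock–Vallin pentagon equation. To state the latter, extend $U$ by zero to $\tilde U=EU\hat E$ on $H\otimes H$, let $\Sigma_{23},\Sigma_{12}$ be the flips, and let $\Sigma_{12,3}(\xi\otimes\eta\otimes\zeta)=\zeta\otimes\xi\otimes\eta$. Denote a threefold relative tensor product in $H^{\otimes3}$ by the product of the two projections whose range it is. Then in the two chains $$\hat E_{12}\hat E_{23}\xrightarrow{\tilde U_{12}}E_{12}\hat E_{23}\xrightarrow{\tilde U_{23}}E_{12}E_{23},$$ $$\hat E_{12}\hat E_{23}\xrightarrow{\tilde U_{23}}\hat E_{13}E_{23}\xrightarrow{\Sigma_{23}}\hat E_{12}E_{32}\xrightarrow{\Sigma_{12,3}}E_{13}\hat E_{23}\xrightarrow{\tilde U_{23}}\hat E_{21}E_{23}\xrightarrow{\Sigma_{12}}\hat E_{12}E_{13}\xrightarrow{\tilde U_{12}}E_{12}E_{23}$$ every arrow restricts to a unitary between the indicated ranges, and the two composites agree on the range of $\hat E_{12}\hat E_{23}$. -/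

import Mathlib

open scoped TensorProduct ComplexOrder

noncomputable section

namespace MPI

/-! ### Leg notation, slice maps -/

section Legs

variable {H : Type*} [AddCommGroup H] [Module ℂ H]

/-- The flip `ξ ⊗ η ↦ η ⊗ ξ`. -/
def flip (H : Type*) [AddCommGroup H] [Module ℂ H] : Module.End ℂ (H ⊗[ℂ] H) :=
  (TensorProduct.comm ℂ H H).toLinearMap

/-- `X₂₃` on `H ⊗ H ⊗ H`. -/
def leg23 (X : Module.End ℂ (H ⊗[ℂ] H)) : Module.End ℂ (H ⊗[ℂ] (H ⊗[ℂ] H)) :=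
  X.lTensor H

/-- `X₁₂` on `H ⊗ H ⊗ H`. -/
def leg12 (X : Module.End ℂ (H ⊗[ℂ] H)) : Module.End ℂ (H ⊗[ℂ] (H ⊗[ℂ] H)) :=
  (TensorProduct.assoc ℂ H H H).toLinearMap ∘ₗ X.rTensor H ∘ₗ
    (TensorProduct.assoc ℂ H H H).symm.toLinearMap

/-- `X₁₃` on `H ⊗ H ⊗ H`. -/
def leg13 (X : Module.End ℂ (H ⊗[ℂ] H)) : Module.End ℂ (H ⊗[ℂ] (H ⊗[ℂ] H)) :=
  leg12 (flip H) * leg23 X * leg12 (flip H)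

/-- `X₂₁` on `H ⊗ H ⊗ H`. -/
def leg21 (X : Module.End ℂ (H ⊗[ℂ] H)) : Module.End ℂ (H ⊗[ℂ] (H ⊗[ℂ] H)) :=
  leg12 (flip H * X * flip H)

/-- `X₃₂` on `H ⊗ H ⊗ H`. -/
def leg32 (X : Module.End ℂ (H ⊗[ℂ] H)) : Module.End ℂ (H ⊗[ℂ] (H ⊗[ℂ] H)) :=
  leg23 (flip H * X * flip H)

/-- The cyclic flip `(ξ ⊗ η) ⊗ ζ ↦ ζ ⊗ (ξ ⊗ η)`. -/
def flip12_3 (H : Type*) [AddCommGroup H] [Module ℂ H] :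
    Module.End ℂ (H ⊗[ℂ] (H ⊗[ℂ] H)) :=
  (TensorProduct.comm ℂ (H ⊗[ℂ] H) H).toLinearMap ∘ₗ
    (TensorProduct.assoc ℂ H H H).symm.toLinearMap

/-- The operator `(β ⊗ γ)(e)` on `H ⊗ H`, for `e ∈ B ⊗ B` and linear maps
`β, γ : B → End H`. -/
def pairOp {B : Type*} [AddCommGroup B] [Module ℂ B]
    (β γ : B →ₗ[ℂ] Module.End ℂ H) (e : B ⊗[ℂ] B) : Module.End ℂ (H ⊗[ℂ] H) :=
  TensorProduct.homTensorHomMap (RingHom.id ℂ) H H H H (TensorProduct.map β γ e)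

variable [FiniteDimensional ℂ H]

/-- `(ω ⊗ id)(X)`, under `End (H ⊗ H) = End H ⊗ End H`. -/
def sliceLeft (ω : Module.Dual ℂ (Module.End ℂ H)) (X : Module.End ℂ (H ⊗[ℂ] H)) :
    Module.End ℂ H :=
  TensorProduct.lid ℂ (Module.End ℂ H)
    (ω.rTensor (Module.End ℂ H) ((homTensorHomEquiv ℂ H H H H).symm X))

/-- `(id ⊗ ω)(X)`, under `End (H ⊗ H) = End H ⊗ End H`. -/
def sliceRight (ω : Module.Dual ℂ (Module.End ℂ H)) (X : Module.End ℂ (H ⊗[ℂ] H)) :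
    Module.End ℂ H :=
  TensorProduct.rid ℂ (Module.End ℂ H)
    (ω.lTensor (Module.End ℂ H) ((homTensorHomEquiv ℂ H H H H).symm X))

end Legs

/-! ### Multiplicative partial isometries -/

section MPIs

variable {H : Type*} [NormedAddCommGroup H] [InnerProductSpace ℂ H] [FiniteDimensional ℂ H]

/-- A multiplicative partial isometry on `H`. -/
structure IsMPI (V : Module.End ℂ (H ⊗[ℂ] H)) : Prop where
  partial_isometry : V * star V * V = V
  pentagon : leg23 V * leg12 V = leg12 V * leg13 V * leg23 V
  range_left : leg13 V * leg23 V * leg23 (star V) = leg12 (star V) * leg12 V * leg13 V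
  range_commute : leg12 V * leg12 (star V) * leg23 V = leg23 V * leg12 V * leg12 (star V)
  domain_commute : leg12 V * leg23 (star V) * leg23 V = leg23 (star V) * leg23 V * leg12 V

/-- The map `ω ↦ λ(ω) = (ω ⊗ id)(V)`; its range is the right leg `A` of `V`. -/
def lam (V : Module.End ℂ (H ⊗[ℂ] H)) (ω : Module.Dual ℂ (Module.End ℂ H)) :
    Module.End ℂ H := sliceLeft ω V

/-- The map `ω ↦ ρ(ω) = (id ⊗ ω)(V)`; its range is the left leg `Â` of `V`. -/
def rho (V : Module.End ℂ (H ⊗[ℂ] H)) (ω : Module.Dual ℂ (Module.End ℂ H)) :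
    Module.End ℂ H := sliceRight ω V

/-- The functionals `ε`, `ε̂` witness that `V` is unital: `λ(ε̂)` and `ρ(ε)` are two-sided
units of the right leg `A` and of the left leg `Â`, respectively. -/
structure IsUnitalBy (V : Module.End ℂ (H ⊗[ℂ] H))
    (ε εhat : Module.Dual ℂ (Module.End ℂ H)) : Prop where
  unit_right_leg : ∀ ω, lam V εhat * lam V ω = lam V ω ∧ lam V ω * lam V εhat = lam V ω
  unit_left_leg : ∀ ω, rho V ε * rho V ω = rho V ω ∧ rho V ω * rho V ε = rho V ω

/-- The left subalgebra `A^L`, i.e. the right leg of `V V*`, as a set of operators. -/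
def leftSub (V : Module.End ℂ (H ⊗[ℂ] H)) : Set (Module.End ℂ H) :=
  Set.range fun ω : Module.Dual ℂ (Module.End ℂ H) => sliceLeft ω (V * star V)

/-- The map `⊓ᴿ(x) = 1₍₁₎ ε(x 1₍₂₎)`, where `1₍₁₎ ⊗ 1₍₂₎ = V V*`. Its restriction to
`A^L` is the would-be antipode `S`. -/
def piR (V : Module.End ℂ (H ⊗[ℂ] H)) (ε : Module.Dual ℂ (Module.End ℂ H))
    (x : Module.End ℂ H) : Module.End ℂ H :=
  sliceRight ε (x.lTensor H * (V * star V))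

end MPIs

/-! ### Functionals on finite-dimensional C*-algebras and the relative tensor product

The algebra `B` is not given a distinguished unit in the type theory, because it will be
a *-subalgebra of `End H` whose unit need not be `1 : End H`. -/

section Functionals

variable {B : Type*} [NonUnitalRing B] [StarRing B] [Module ℂ B]

/-- `e` is a two-sided unit of `B`. -/
def IsUnitElem (e : B) : Prop := ∀ x : B, e * x = x ∧ x * e = x

/-- `ψ` is a faithful positive functional. -/
def IsFaithfulPositive (ψ : B →ₗ[ℂ] ℂ) : Prop :=
  (∀ x : B, 0 ≤ ψ (star x * x)) ∧ ∀ x : B, ψ (star x * x) = 0 → x = 0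

/-- `b` is the basis dual to the basis `a` with respect to `ψ`: `ψ(bᵢ aⱼ) = δᵢⱼ`. -/
def IsDualFamily (ψ : B →ₗ[ℂ] ℂ) {n : ℕ} (a : Module.Basis (Fin n) ℂ B) (b : Fin n → B) :
    Prop :=
  ∀ i j, ψ (b i * a j) = if i = j then 1 else 0

/-- `l` is the index `∑ aᵢ bᵢ` of `ψ`. -/
def IsIndex (ψ : B →ₗ[ℂ] ℂ) (l : B) : Prop :=
  ∃ (n : ℕ) (a : Module.Basis (Fin n) ℂ B) (b : Fin n → B),
    IsDualFamily ψ a b ∧ l = ∑ i, a i * b i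

/-- `θ` is the square root `θ_ψ^{1/2}` of the modular automorphism of `ψ`. Here `g` is a
positive invertible element, with inverse `k`, whose square `g²` implements the modular
automorphism `θ_ψ(x) = g² x k²`, which is characterised by `ψ(x y) = ψ(y θ_ψ(x))`;
then `θ(x) = g x k`. -/
def IsModularSqrt (ψ : B →ₗ[ℂ] ℂ) (θ : B ≃ₗ[ℂ] B) : Prop :=
  ∃ e g k : B, IsUnitElem e ∧ (∃ c : B, g = star c * c) ∧ g * k = e ∧ k * g = e ∧
    (∀ x y : B, ψ (x * y) = ψ (y * ((g * g) * x * (k * k)))) ∧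
    ∀ x : B, θ x = g * x * k

/-- `q` is the element `e_ψ = ∑ l⁻¹ aᵢ ⊗ θ_ψ^{1/2}(bᵢ)` of `B ⊗ B`, where `{aᵢ}` is a basis,
`{bᵢ}` the dual basis with respect to `ψ`, and `l = ∑ aᵢ bᵢ` the index of `ψ`, with inverse
`m`. (It is independent of the choices; its first factor is regarded as lying in `Bᵒᵖ`.) -/
def IsRelElement (ψ : B →ₗ[ℂ] ℂ) (q : B ⊗[ℂ] B) : Prop :=
  ∃ (n : ℕ) (a : Module.Basis (Fin n) ℂ B) (b : Fin n → B) (e m : B) (θ : B ≃ₗ[ℂ] B),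
    IsDualFamily ψ a b ∧ IsUnitElem e ∧
    m * (∑ i, a i * b i) = e ∧ (∑ i, a i * b i) * m = e ∧
    IsModularSqrt ψ θ ∧ q = ∑ i, (m * a i) ⊗ₜ[ℂ] θ (b i)

/-- The functional `ψᵒ` on the opposite algebra. -/
def opFunctional (ψ : B →ₗ[ℂ] ℂ) : Bᵐᵒᵖ →ₗ[ℂ] ℂ :=
  ψ ∘ₗ (MulOpposite.opLinearEquiv ℂ : B ≃ₗ[ℂ] Bᵐᵒᵖ).symm.toLinearMap

variable {H : Type*} [NormedAddCommGroup H] [InnerProductSpace ℂ H] [FiniteDimensional ℂ H]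

/-- A left action of `B`: a *-homomorphism `B → End H`. -/
structure IsLeftAction (γ : B →ₗ[ℂ] Module.End ℂ H) : Prop where
  map_mul : ∀ x y, γ (x * y) = γ x * γ y
  map_star : ∀ x, γ (star x) = star (γ x)

/-- A right action of `B`: a *-homomorphism `Bᵒᵖ → End H`. -/
structure IsRightAction (β : B →ₗ[ℂ] Module.End ℂ H) : Prop where
  map_mul : ∀ x y, β (x * y) = β y * β x
  map_star : ∀ x, β (star x) = star (β x)

/-- A right (left) `B`-action read as a left (right) action of `Bᵒᵖ`. -/
def opAction (γ : B →ₗ[ℂ] Module.End ℂ H) : Bᵐᵒᵖ →ₗ[ℂ] Module.End ℂ H :=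
  γ ∘ₗ (MulOpposite.opLinearEquiv ℂ : B ≃ₗ[ℂ] Bᵐᵒᵖ).symm.toLinearMap

/-- `E` is the projection `E_ψ = (β ⊗ γ)(e_ψ)` whose range is the relative tensor product
`H_β ⊗_ψ γH`, for a right action `β` and a left action `γ` of `B`. -/
def IsRelTensorProj (ψ : B →ₗ[ℂ] ℂ) (β γ : B →ₗ[ℂ] Module.End ℂ H)
    (E : Module.End ℂ (H ⊗[ℂ] H)) : Prop :=
  IsRightAction β ∧ IsLeftAction γ ∧ ∃ q : B ⊗[ℂ] B, IsRelElement ψ q ∧ E = pairOp β γ q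

end Functionals

/-! ### Pseudo-multiplicative unitaries -/

section PMU

variable {H : Type*} [NormedAddCommGroup H] [InnerProductSpace ℂ H] [FiniteDimensional ℂ H]

/-- `U`, defined on the range of `F`, extended by zero along `F` to an operator on `H ⊗ H`:
the operator `E U F`. -/
def extend {E F : Module.End ℂ (H ⊗[ℂ] H)}
    (U : LinearMap.range F ≃ₗᵢ[ℂ] LinearMap.range E) : Module.End ℂ (H ⊗[ℂ] H) :=
  (LinearMap.range E).subtype ∘ₗ U.toLinearEquiv.toLinearMap ∘ₗ F.rangeRestrict

/-- `f` restricts to a unitary from the subspace which is the range of `P` onto the subspace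
which is the range of `Q`. -/
def RestrictsToUnitary (f P Q : Module.End ℂ (H ⊗[ℂ] (H ⊗[ℂ] H))) : Prop :=
  Set.BijOn f (LinearMap.range P) (LinearMap.range Q) ∧
    ∀ ξ ∈ LinearMap.range P, ‖f ξ‖ = ‖ξ‖

/-- The pentagon diagram for `U : H_β̂ ⊗_{νᵒ} αH → H_α ⊗_ν βH`, where `F` and `E` are the
projections defining the two relative tensor products.

A factor `H` stands for a triangle `(ijk)`, `i < j < k`, whose edges `ij`, `jk`, `ik` carry the
actions `β`, `β̂`, `α`. The eight corners of the diagram are threefold relative tensor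
products, realised as subspaces of `H ⊗ H ⊗ H`; each is the range of the product of the two
projections for its two interior edges:

* `(014)(124)(234)`, glued along `14` and `24`: `F₁₂ F₂₃`
* `(012)(024)(234)`, glued along `02` and `24`: `E₁₂ F₂₃`
* `(012)(023)(034)`, glued along `02` and `03`: `E₁₂ E₂₃`
* `(014)(123)(134)`, glued along `14` and `13`: `F₁₃ E₂₃`
* `(014)(134)(123)`, glued along `14` and `13`: `F₁₂ E₃₂`
* `(123)(014)(134)`, glued along `13` and `14`: `E₁₃ F₂₃`
* `(123)(013)(034)`, glued along `13` and `03`: `F₂₁ E₂₃`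
* `(013)(123)(034)`, glued along `13` and `03`: `F₁₂ E₁₃` -/
structure PentagonDiagram {E F : Module.End ℂ (H ⊗[ℂ] H)}
    (U : LinearMap.range F ≃ₗᵢ[ℂ] LinearMap.range E) : Prop where
  upper₁ : RestrictsToUnitary (leg12 (extend U)) (leg12 F * leg23 F) (leg12 E * leg23 F)
  upper₂ : RestrictsToUnitary (leg23 (extend U)) (leg12 E * leg23 F) (leg12 E * leg23 E)
  lower₁ : RestrictsToUnitary (leg23 (extend U)) (leg12 F * leg23 F) (leg13 F * leg23 E)
  lower₂ : RestrictsToUnitary (leg23 (flip H)) (leg13 F * leg23 E) (leg12 F * leg32 E)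
  lower₃ : RestrictsToUnitary (flip12_3 H) (leg12 F * leg32 E) (leg13 E * leg23 F)
  lower₄ : RestrictsToUnitary (leg23 (extend U)) (leg13 E * leg23 F) (leg21 F * leg23 E)
  lower₅ : RestrictsToUnitary (leg12 (flip H)) (leg21 F * leg23 E) (leg12 F * leg13 E)
  lower₆ : RestrictsToUnitary (leg12 (extend U)) (leg12 F * leg13 E) (leg12 E * leg23 E)
  commutes : ∀ ξ ∈ LinearMap.range (leg12 F * leg23 F),
    leg23 (extend U) (leg12 (extend U) ξ) =
      leg12 (extend U) (leg12 (flip H) (leg23 (extend U) (flip12_3 H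
        (leg23 (flip H) (leg23 (extend U) ξ)))))

/-- `U` intertwines the action by the operators `x ↦ S x` on the range of `F` with the action
by the operators `x ↦ T x` on the range of `E` (both ranges being invariant). -/
def Intertwines {B : Type*} {E F : Module.End ℂ (H ⊗[ℂ] H)}
    (U : LinearMap.range F ≃ₗᵢ[ℂ] LinearMap.range E)
    (S T : B → Module.End ℂ (H ⊗[ℂ] H)) : Prop :=
  ∀ (x : B) (ξ : LinearMap.range F), ∃ h : S x ξ ∈ LinearMap.range F,
    (U ⟨S x ξ, h⟩ : H ⊗[ℂ] H) = T x (U ξ)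

/-- Pseudo-multiplicative unitaries on a finite-dimensional Hilbert space, over a
finite-dimensional C*-algebra `B` with faithful positive functional `ν`. Here `β` and `β̂` are
left actions and `α` is a right action of `B`. (As `β` is a faithful *-representation, `B` is
a finite-dimensional C*-algebra.) -/
structure IsPseudoMultiplicativeUnitary {B : Type*} [NonUnitalRing B] [StarRing B] [Module ℂ B]
    (ν : B →ₗ[ℂ] ℂ) (β α βhat : B →ₗ[ℂ] Module.End ℂ H) {E F : Module.End ℂ (H ⊗[ℂ] H)}
    (U : LinearMap.range F ≃ₗᵢ[ℂ] LinearMap.range E) : Prop where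
  faithful_positive : IsFaithfulPositive ν
  left_β : IsLeftAction β
  right_α : IsRightAction α
  left_βhat : IsLeftAction βhat
  injective_β : Function.Injective β
  injective_α : Function.Injective α
  injective_βhat : Function.Injective βhat
  commute_α_β : ∀ x y, Commute (α x) (β y)
  commute_α_βhat : ∀ x y, Commute (α x) (βhat y)
  commute_β_βhat : ∀ x y, Commute (β x) (βhat y)
  /-- The target is the range of the projection for `H_α ⊗_ν βH`. -/
  target : IsRelTensorProj ν α β E
  /-- The source is the range of the projection for `H_β̂ ⊗_{νᵒ} αH`. -/
  source : IsRelTensorProj (opFunctional ν) (opAction βhat) (opAction α) F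
  intertwines₀₁ : Intertwines U (fun x => (β x).rTensor H) fun x => (β x).rTensor H
  intertwines₁₂ : Intertwines U (fun x => (β x).lTensor H) fun x => (βhat x).rTensor H
  intertwines₂₃ : Intertwines U (fun x => (βhat x).lTensor H) fun x => (βhat x).lTensor H
  intertwines₀₃ : Intertwines U (fun x => (α x).rTensor H) fun x => (α x).lTensor H
  pentagon : PentagonDiagram U

end PMU

end MPI

end

/-! Write E = VV*, F = V*V; let B = A^L be the right leg of E, C the left leg of E and D the left
leg of F. Sliced in one leg, the axioms other than the pentagon are exchange rules: b ⊗ 1 (b in B)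
and 1 ⊗ d (d in D) commute with V, and V(1 ⊗ b) = (d ⊗ 1)V when b and d are the slices of E and F by
one functional. With the pentagon they give V₁₂V₁₃ = V₂₃V₁₂V₂₃* and V₁₃V₂₃ = V₁₂*V₂₃V₁₂, so x ↦ V(x
⊗ 1)V* behaves as a coproduct on A with counit ε. The units force the right leg of F to be C, the
two units to coincide (`unit_eq`), and V(c ⊗ 1) = (1 ⊗ c)V for c in C (`mul_rTensor_left`). These
rules contain all the commutation and intertwining relations.

B consists of the x in A for which x ⊗ 1 commutes with V (`mem_range_right_iff`), hence is an
algebra. The map S = `targetMap` sends A into C and satisfies ε(S(x)y) = ε(xy); since B and C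
commute, S is antimultiplicative on B (`targetMap_mul`). The pairing ε(cb) reproduces the slices of
E (`counit_pairing`), so ε is nondegenerate on B and E = ∑ S(bᵢ) ⊗ aᵢ for dual bases. Then E² = E
says that the index is 1 (`sum_mul_eq_unit`).

Positivity comes from the trace. The operator m = (Tr ⊗ id)(E) is positive, lies in B, is invertible
there, and ε(xm) = Tr S(x). Hence ε(x) = Tr S(xm⁻¹), and since Tr ∘ S is tracial on B, the modular
automorphism is x ↦ m⁻¹xm. With k = m^{1/2} and g = k⁻¹, the map S_o(x) = S(kxg) preserves adjoints
and ε(x*x) = Tr(YY*) for Y = S(kxg²), which is positive and faithful.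

In the relative tensor product the square root of the modular automorphism cancels the twist in S_o,
which leaves exactly E and F. In the pentagon diagram every arrow is a flip or a partial isometry
intertwining the remaining projections, and since Σ₁₂Σ₂₃ = Σ₁₂,₃ the two composites are the two
sides of the pentagon equation. -/

noncomputable section

namespace MPI

/-! ### Slice maps and legs of operators on a tensor product -/

section Slices

variable {M N : Type*} [AddCommGroup M] [Module ℂ M] [FiniteDimensional ℂ M]
  [AddCommGroup N] [Module ℂ N] [FiniteDimensional ℂ N]

/-- Operators on a tensor product are sums of elementary ones. -/
theorem end_tensor_induction {P : Module.End ℂ (M ⊗[ℂ] N) → Prop}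
    (X : Module.End ℂ (M ⊗[ℂ] N))
    (map : ∀ (x : Module.End ℂ M) (y : Module.End ℂ N), P (TensorProduct.map x y))
    (add : ∀ X Y, P X → P Y → P (X + Y)) : P X := by
  obtain ⟨t, rfl⟩ := (homTensorHomEquiv ℂ M N M N).surjective X
  induction t using TensorProduct.induction_on with
  | zero => simpa using map 0 0
  | tmul x y => simpa [homTensorHomEquiv_apply] using map x y
  | add a b ha hb => rw [map_add]; exact add _ _ ha hb

/-- The slice map `ω ⊗ id` on operators on `M ⊗ N`. -/
def sliceL (ω : Module.Dual ℂ (Module.End ℂ M)) :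
    Module.End ℂ (M ⊗[ℂ] N) →ₗ[ℂ] Module.End ℂ N :=
  (TensorProduct.lid ℂ (Module.End ℂ N)).toLinearMap ∘ₗ
    ω.rTensor (Module.End ℂ N) ∘ₗ (homTensorHomEquiv ℂ M N M N).symm.toLinearMap

/-- The slice map `id ⊗ ω` on operators on `M ⊗ N`. -/
def sliceR (ω : Module.Dual ℂ (Module.End ℂ N)) :
    Module.End ℂ (M ⊗[ℂ] N) →ₗ[ℂ] Module.End ℂ M :=
  (TensorProduct.rid ℂ (Module.End ℂ M)).toLinearMap ∘ₗ
    ω.lTensor (Module.End ℂ M) ∘ₗ (homTensorHomEquiv ℂ M N M N).symm.toLinearMap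

theorem homTensorHomEquiv_symm_map (x : Module.End ℂ M) (y : Module.End ℂ N) :
    (homTensorHomEquiv ℂ M N M N).symm (TensorProduct.map x y) = x ⊗ₜ[ℂ] y := by
  rw [LinearEquiv.symm_apply_eq]; simp [homTensorHomEquiv_apply]

@[simp] theorem sliceL_map (ω : Module.Dual ℂ (Module.End ℂ M)) (x : Module.End ℂ M)
    (y : Module.End ℂ N) : sliceL ω (TensorProduct.map x y) = ω x • y := by
  simp [sliceL, homTensorHomEquiv_symm_map]

@[simp] theorem sliceR_map (ω : Module.Dual ℂ (Module.End ℂ N)) (x : Module.End ℂ M)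
    (y : Module.End ℂ N) : sliceR ω (TensorProduct.map x y) = ω y • x := by
  simp [sliceR, homTensorHomEquiv_symm_map]

theorem sliceL_add_left (ω ω' : Module.Dual ℂ (Module.End ℂ M)) (X : Module.End ℂ (M ⊗[ℂ] N)) :
    sliceL (ω + ω') X = sliceL ω X + sliceL ω' X := by
  simp [sliceL, LinearMap.rTensor_add]

theorem sliceR_add_left (ω ω' : Module.Dual ℂ (Module.End ℂ N)) (X : Module.End ℂ (M ⊗[ℂ] N)) :
    sliceR (ω + ω') X = sliceR ω X + sliceR ω' X := by
  simp [sliceR, LinearMap.lTensor_add]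

theorem sliceL_smul_left (a : ℂ) (ω : Module.Dual ℂ (Module.End ℂ M))
    (X : Module.End ℂ (M ⊗[ℂ] N)) : sliceL (a • ω) X = a • sliceL ω X := by
  simp [sliceL, LinearMap.rTensor_smul]

theorem sliceR_smul_left (a : ℂ) (ω : Module.Dual ℂ (Module.End ℂ N))
    (X : Module.End ℂ (M ⊗[ℂ] N)) : sliceR (a • ω) X = a • sliceR ω X := by
  simp [sliceR, LinearMap.lTensor_smul]

/-- The right leg of an operator: the space of its slices `(ω ⊗ id)(X)`. -/
def rightLeg (X : Module.End ℂ (M ⊗[ℂ] N)) : Submodule ℂ (Module.End ℂ N) :=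
  LinearMap.range ({ toFun := fun ω => sliceL ω X
                     map_add' := fun ω ω' => sliceL_add_left ω ω' X
                     map_smul' := fun a ω => sliceL_smul_left a ω X } :
    Module.Dual ℂ (Module.End ℂ M) →ₗ[ℂ] Module.End ℂ N)

/-- The left leg of an operator: the space of its slices `(id ⊗ ω)(X)`. -/
def leftLeg (X : Module.End ℂ (M ⊗[ℂ] N)) : Submodule ℂ (Module.End ℂ M) :=
  LinearMap.range ({ toFun := fun ω => sliceR ω X
                     map_add' := fun ω ω' => sliceR_add_left ω ω' X
                     map_smul' := fun a ω => sliceR_smul_left a ω X } :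
    Module.Dual ℂ (Module.End ℂ N) →ₗ[ℂ] Module.End ℂ M)

theorem sliceL_mem_rightLeg (ω : Module.Dual ℂ (Module.End ℂ M)) (X : Module.End ℂ (M ⊗[ℂ] N)) :
    sliceL ω X ∈ rightLeg X := ⟨ω, rfl⟩

theorem sliceR_mem_leftLeg (ω : Module.Dual ℂ (Module.End ℂ N)) (X : Module.End ℂ (M ⊗[ℂ] N)) :
    sliceR ω X ∈ leftLeg X := ⟨ω, rfl⟩

theorem sliceL_lTensor_mul (ω : Module.Dual ℂ (Module.End ℂ M)) (y : Module.End ℂ N)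
    (X : Module.End ℂ (M ⊗[ℂ] N)) : sliceL ω (y.lTensor M * X) = y * sliceL ω X := by
  induction X using end_tensor_induction with
  | map a b =>
    rw [show y.lTensor M = TensorProduct.map 1 y from rfl, ← TensorProduct.map_mul]
    simp
  | add X Y hX hY => simp only [mul_add, map_add, hX, hY]

theorem sliceL_mul_lTensor (ω : Module.Dual ℂ (Module.End ℂ M)) (y : Module.End ℂ N)
    (X : Module.End ℂ (M ⊗[ℂ] N)) : sliceL ω (X * y.lTensor M) = sliceL ω X * y := by
  induction X using end_tensor_induction with
  | map a b =>
    rw [show y.lTensor M = TensorProduct.map 1 y from rfl, ← TensorProduct.map_mul]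
    simp
  | add X Y hX hY => simp only [add_mul, map_add, hX, hY]

theorem apply_sliceR (f : Module.Dual ℂ (Module.End ℂ M)) (k : Module.Dual ℂ (Module.End ℂ N))
    (X : Module.End ℂ (M ⊗[ℂ] N)) : f (sliceR k X) = k (sliceL f X) := by
  induction X using end_tensor_induction with
  | map x y => simp [mul_comm]
  | add X Y hX hY => simp [hX, hY]

theorem eq_of_sliceL {X Y : Module.End ℂ (M ⊗[ℂ] N)} (h : ∀ ω, sliceL ω X = sliceL ω Y) :
    X = Y := by
  let b := Module.finBasis ℂ (Module.End ℂ M)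
  -- The slices by the coordinate functionals of a basis of `End M` are the coefficients of the
  -- operator.
  have key : ∀ Z : Module.End ℂ (M ⊗[ℂ] N),
      Z = ∑ i, TensorProduct.map (b i) (sliceL (b.coord i) Z) := by
    intro Z
    induction Z using end_tensor_induction with
    | map x y =>
      have h := congrArg ((TensorProduct.mapBilinear (RingHom.id ℂ) M N M N).flip y)
        (b.sum_repr x)
      rw [map_sum] at h
      simpa [TensorProduct.map_smul_right] using h.symm
    | add Z W hZ hW =>
      conv_lhs => rw [hZ, hW]
      simp [TensorProduct.map_add_right, Finset.sum_add_distrib]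
  rw [key X, key Y]
  simp [h]

theorem dual_ext {W : Type*} [AddCommGroup W] [Module ℂ W] {x y : W}
    (h : ∀ f : Module.Dual ℂ W, f x = f y) : x = y := by
  rw [← sub_eq_zero, ← Module.forall_dual_apply_eq_zero_iff ℂ]
  intro f
  rw [map_sub, h, sub_self]

theorem eq_of_sliceR {X Y : Module.End ℂ (M ⊗[ℂ] N)} (h : ∀ ω, sliceR ω X = sliceR ω Y) :
    X = Y := by
  refine eq_of_sliceL fun f => dual_ext fun k => ?_
  rw [← apply_sliceR, ← apply_sliceR, h]

end Slices

/-! ### Leg notation and flips on three tensor factors -/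

section Legs

variable {H : Type*} [AddCommGroup H] [Module ℂ H]

theorem rTensor_eq_map (x : Module.End ℂ H) : x.rTensor H = TensorProduct.map x 1 := rfl
theorem lTensor_eq_map (x : Module.End ℂ H) : x.lTensor H = TensorProduct.map 1 x := rfl

theorem map_mul_map {M N : Type*} [AddCommGroup M] [Module ℂ M] [AddCommGroup N] [Module ℂ N]
    (x x' : Module.End ℂ M) (y y' : Module.End ℂ N) :
    TensorProduct.map x y * TensorProduct.map x' y' = TensorProduct.map (x * x') (y * y') :=
  (TensorProduct.map_mul x x' y y').symm

@[simp] theorem leg23_map (x y : Module.End ℂ H) :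
    leg23 (TensorProduct.map x y) = TensorProduct.map 1 (TensorProduct.map x y) := rfl

@[simp] theorem leg12_map (x y : Module.End ℂ H) :
    leg12 (TensorProduct.map x y) = TensorProduct.map x (TensorProduct.map y 1) := by
  ext a b c; simp [leg12]

theorem flip_mul_map_mul_flip (x y : Module.End ℂ H) :
    flip H * TensorProduct.map x y * flip H = TensorProduct.map y x := by
  ext a b; simp [flip]

theorem leg12_flip_conj_map (x y z : Module.End ℂ H) :
    leg12 (flip H) * TensorProduct.map x (TensorProduct.map y z) * leg12 (flip H) =
      TensorProduct.map y (TensorProduct.map x z) := by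
  ext a b c; simp [leg12, flip]

theorem leg23_flip_conj_map (x y z : Module.End ℂ H) :
    leg23 (flip H) * TensorProduct.map x (TensorProduct.map y z) * leg23 (flip H) =
      TensorProduct.map x (TensorProduct.map z y) := by
  ext a b c; simp [leg23, flip]

theorem flip12_3_map (x y z : Module.End ℂ H) :
    flip12_3 H * TensorProduct.map x (TensorProduct.map y z) =
      TensorProduct.map z (TensorProduct.map x y) * flip12_3 H := by
  ext a b c; simp [flip12_3]

@[simp] theorem leg13_map (x y : Module.End ℂ H) :
    leg13 (TensorProduct.map x y) = TensorProduct.map x (TensorProduct.map 1 y) := by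
  rw [leg13, leg23_map, leg12_flip_conj_map]

@[simp] theorem leg21_map (x y : Module.End ℂ H) :
    leg21 (TensorProduct.map x y) = TensorProduct.map y (TensorProduct.map x 1) := by
  rw [leg21, flip_mul_map_mul_flip, leg12_map]

@[simp] theorem leg32_map (x y : Module.End ℂ H) :
    leg32 (TensorProduct.map x y) = TensorProduct.map 1 (TensorProduct.map y x) := by
  rw [leg32, flip_mul_map_mul_flip, leg23_map]

@[simp] theorem leg12_add (X Y : Module.End ℂ (H ⊗[ℂ] H)) :
    leg12 (X + Y) = leg12 X + leg12 Y := by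
  simp [leg12, LinearMap.rTensor_add, LinearMap.add_comp, LinearMap.comp_add]

@[simp] theorem leg23_add (X Y : Module.End ℂ (H ⊗[ℂ] H)) :
    leg23 (X + Y) = leg23 X + leg23 Y := by
  simp [leg23, LinearMap.lTensor_add]

@[simp] theorem leg13_add (X Y : Module.End ℂ (H ⊗[ℂ] H)) :
    leg13 (X + Y) = leg13 X + leg13 Y := by
  simp [leg13, mul_add, add_mul]

@[simp] theorem leg21_add (X Y : Module.End ℂ (H ⊗[ℂ] H)) :
    leg21 (X + Y) = leg21 X + leg21 Y := by
  simp [leg21, mul_add, add_mul]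

@[simp] theorem leg32_add (X Y : Module.End ℂ (H ⊗[ℂ] H)) :
    leg32 (X + Y) = leg32 X + leg32 Y := by
  simp [leg32, mul_add, add_mul]

theorem leg23_mul (X Y : Module.End ℂ (H ⊗[ℂ] H)) : leg23 (X * Y) = leg23 X * leg23 Y :=
  LinearMap.lTensor_mul _ _ _

theorem leg12_mul (X Y : Module.End ℂ (H ⊗[ℂ] H)) : leg12 (X * Y) = leg12 X * leg12 Y := by
  apply LinearMap.ext; intro z
  simp [leg12, LinearMap.rTensor_mul]

theorem flip_mul_flip : flip H * flip H = 1 := by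
  ext a b; simp [flip]

theorem leg12_one : leg12 (1 : Module.End ℂ (H ⊗[ℂ] H)) = 1 := by
  ext a b c; simp [leg12]

theorem leg23_one : leg23 (1 : Module.End ℂ (H ⊗[ℂ] H)) = 1 := by
  ext a b c; simp [leg23]

theorem leg12_flip_mul_self : leg12 (flip H) * leg12 (flip H) = 1 := by
  rw [← leg12_mul, flip_mul_flip, leg12_one]

theorem leg23_flip_mul_self : leg23 (flip H) * leg23 (flip H) = 1 := by
  rw [← leg23_mul, flip_mul_flip, leg23_one]

theorem leg13_mul (X Y : Module.End ℂ (H ⊗[ℂ] H)) : leg13 (X * Y) = leg13 X * leg13 Y := by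
  simp only [leg13, leg23_mul]
  simp only [mul_assoc]
  rw [← mul_assoc (leg12 (flip H)) (leg12 (flip H)), leg12_flip_mul_self, one_mul]

variable (X : Module.End ℂ (H ⊗[ℂ] H)) (ω : Module.Dual ℂ (Module.End ℂ H))

theorem leg12_flip_mul_leg13 : leg12 (flip H) * leg13 X = leg23 X * leg12 (flip H) := by
  rw [leg13, ← mul_assoc, ← mul_assoc, leg12_flip_mul_self, one_mul]

theorem leg12_flip_mul_leg21 : leg12 (flip H) * leg21 X = leg12 X * leg12 (flip H) := by
  rw [leg21, leg12_mul, leg12_mul, ← mul_assoc, ← mul_assoc, leg12_flip_mul_self, one_mul]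

theorem leg12_flip_mul_leg23 : leg12 (flip H) * leg23 X = leg13 X * leg12 (flip H) := by
  rw [leg13, mul_assoc, leg12_flip_mul_self, mul_one]

theorem leg23_flip_mul_leg23 : leg23 (flip H) * leg23 X = leg32 X * leg23 (flip H) := by
  rw [leg32, leg23_mul, leg23_mul, mul_assoc _ (leg23 (flip H)), leg23_flip_mul_self, mul_one]

theorem flip12_3_mul_leg23_flip : flip12_3 H * leg23 (flip H) = leg12 (flip H) := by
  ext a b c; simp [flip12_3, leg23, leg12, flip]

theorem flip12_3_eq : flip12_3 H = leg12 (flip H) * leg23 (flip H) := by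
  rw [← flip12_3_mul_leg23_flip, mul_assoc, leg23_flip_mul_self, mul_one]

theorem comp_mulLeft_add (x y : Module.End ℂ H) : ω ∘ₗ LinearMap.mulLeft ℂ (x + y) =
    ω ∘ₗ LinearMap.mulLeft ℂ x + ω ∘ₗ LinearMap.mulLeft ℂ y := by
  ext; simp [add_mul]

theorem comp_mulRight_add (x y : Module.End ℂ H) : ω ∘ₗ LinearMap.mulRight ℂ (x + y) =
    ω ∘ₗ LinearMap.mulRight ℂ x + ω ∘ₗ LinearMap.mulRight ℂ y := by
  ext; simp [mul_add]

end Legs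

/-! ### Slices of operators on three tensor factors -/

section ThreeLegs

variable {H : Type*} [AddCommGroup H] [Module ℂ H] [FiniteDimensional ℂ H]

/-- `ω ⊗ id ⊗ id`. -/
def slice1 (ω : Module.Dual ℂ (Module.End ℂ H)) :
    Module.End ℂ (H ⊗[ℂ] (H ⊗[ℂ] H)) →ₗ[ℂ] Module.End ℂ (H ⊗[ℂ] H) :=
  sliceL ω

/-- `id ⊗ ω ⊗ id`. -/
def slice2 (ω : Module.Dual ℂ (Module.End ℂ H)) :
    Module.End ℂ (H ⊗[ℂ] (H ⊗[ℂ] H)) →ₗ[ℂ] Module.End ℂ (H ⊗[ℂ] H) :=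
  sliceL ω ∘ₗ LinearMap.mulLeft ℂ (leg12 (flip H)) ∘ₗ LinearMap.mulRight ℂ (leg12 (flip H))

/-- `id ⊗ id ⊗ ω`. -/
def slice3 (ω : Module.Dual ℂ (Module.End ℂ H)) :
    Module.End ℂ (H ⊗[ℂ] (H ⊗[ℂ] H)) →ₗ[ℂ] Module.End ℂ (H ⊗[ℂ] H) :=
  sliceR ω ∘ₗ (TensorProduct.assoc ℂ H H H).symm.conj.toLinearMap

variable (ω k : Module.Dual ℂ (Module.End ℂ H)) (x y z : Module.End ℂ H)
  (X Y Z : Module.End ℂ (H ⊗[ℂ] H))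

@[simp] theorem slice1_map : slice1 ω (TensorProduct.map x (TensorProduct.map y z)) =
    ω x • TensorProduct.map y z := by
  simp [slice1]

@[simp] theorem slice2_map : slice2 ω (TensorProduct.map x (TensorProduct.map y z)) =
    ω y • TensorProduct.map x z := by
  simp only [slice2, LinearMap.comp_apply, LinearMap.mulLeft_apply, LinearMap.mulRight_apply]
  rw [← mul_assoc, leg12_flip_conj_map, sliceL_map]

@[simp] theorem slice3_map : slice3 ω (TensorProduct.map x (TensorProduct.map y z)) =
    ω z • TensorProduct.map x y := by
  have : (TensorProduct.assoc ℂ H H H).symm.conj (TensorProduct.map x (TensorProduct.map y z)) =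
      TensorProduct.map (TensorProduct.map x y) z := by
    ext a b c; simp [LinearEquiv.conj_apply]
  simp [slice3, this]

theorem sliceR_rTensor_mul : sliceR ω (y.rTensor H * X) = y * sliceR ω X := by
  induction X using end_tensor_induction with
  | map a b => simp [rTensor_eq_map, map_mul_map]
  | add X Y hX hY => simp only [mul_add, map_add, hX, hY]

theorem sliceR_mul_rTensor : sliceR ω (X * y.rTensor H) = sliceR ω X * y := by
  induction X using end_tensor_induction with
  | map a b => simp [rTensor_eq_map, map_mul_map]
  | add X Y hX hY => simp only [add_mul, map_add, hX, hY]

theorem sliceL_rTensor_mul :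
    sliceL ω (y.rTensor H * X) = sliceL (ω ∘ₗ LinearMap.mulLeft ℂ y) X := by
  induction X using end_tensor_induction with
  | map a b => simp [rTensor_eq_map, map_mul_map]
  | add X Y hX hY => simp only [mul_add, map_add, hX, hY]

theorem sliceR_lTensor_mul :
    sliceR ω (y.lTensor H * X) = sliceR (ω ∘ₗ LinearMap.mulLeft ℂ y) X := by
  induction X using end_tensor_induction with
  | map a b => simp [lTensor_eq_map, map_mul_map]
  | add X Y hX hY => simp only [mul_add, map_add, hX, hY]

theorem sliceR_mul_lTensor :
    sliceR ω (X * y.lTensor H) = sliceR (ω ∘ₗ LinearMap.mulRight ℂ y) X := by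
  induction X using end_tensor_induction with
  | map a b => simp [lTensor_eq_map, map_mul_map]
  | add X Y hX hY => simp only [add_mul, map_add, hX, hY]

variable {X} in
theorem commute_lTensor_iff {b : Module.End ℂ H} :
    Commute (b.lTensor H) X ↔ ∀ y ∈ rightLeg X, Commute b y := by
  constructor
  · rintro h _ ⟨ω, rfl⟩
    have := congrArg (sliceL ω) h.eq
    rwa [sliceL_lTensor_mul, sliceL_mul_lTensor] at this
  · intro h
    refine eq_of_sliceL fun ω => ?_
    rw [sliceL_lTensor_mul, sliceL_mul_lTensor]
    exact h _ (sliceL_mem_rightLeg ω X)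

variable {X} in
theorem commute_rTensor_iff {b : Module.End ℂ H} :
    Commute (b.rTensor H) X ↔ ∀ y ∈ leftLeg X, Commute b y := by
  constructor
  · rintro h _ ⟨ω, rfl⟩
    have := congrArg (sliceR ω) h.eq
    rwa [sliceR_rTensor_mul, sliceR_mul_rTensor] at this
  · intro h
    refine eq_of_sliceR fun ω => ?_
    rw [sliceR_rTensor_mul, sliceR_mul_rTensor]
    exact h _ (sliceR_mem_leftLeg ω X)

theorem slice2_leg13_mul_leg23 :
    slice2 ω (leg13 X * leg23 Y) = X * (sliceL ω Y).lTensor H := by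
  induction X using end_tensor_induction with
  | add X X' hX hY => simp only [leg13_add, add_mul, map_add, hX, hY]
  | map a b =>
    induction Y using end_tensor_induction with
    | add X X' hX hY => simp only [leg23_add, mul_add, map_add, hX, hY, LinearMap.lTensor_add]
    | map c d => simp [lTensor_eq_map, map_mul_map]

theorem slice2_leg12_mul_leg13 :
    slice2 ω (leg12 X * leg13 Y) = (sliceR ω X).rTensor H * Y := by
  induction X using end_tensor_induction with
  | add X X' hX hY => simp only [leg12_add, add_mul, map_add, hX, hY, LinearMap.rTensor_add]
  | map a b =>
    induction Y using end_tensor_induction with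
    | add X X' hX hY => simp only [leg13_add, mul_add, map_add, hX, hY]
    | map c d => simp [rTensor_eq_map, map_mul_map]

theorem slice1_leg12_mul_leg23 :
    slice1 ω (leg12 X * leg23 Y) = (sliceL ω X).rTensor H * Y := by
  induction X using end_tensor_induction with
  | add X X' hX hY => simp only [leg12_add, add_mul, map_add, hX, hY, LinearMap.rTensor_add]
  | map a b =>
    induction Y using end_tensor_induction with
    | add X X' hX hY => simp only [leg23_add, mul_add, map_add, hX, hY]
    | map c d => simp [rTensor_eq_map, map_mul_map]

theorem slice1_leg23_mul (T : Module.End ℂ (H ⊗[ℂ] (H ⊗[ℂ] H))) :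
    slice1 ω (leg23 Y * T) = Y * slice1 ω T :=
  sliceL_lTensor_mul _ _ _

theorem slice1_mul_leg23 (T : Module.End ℂ (H ⊗[ℂ] (H ⊗[ℂ] H))) :
    slice1 ω (T * leg23 Y) = slice1 ω T * Y :=
  sliceL_mul_lTensor _ _ _

theorem slice1_leg12 : slice1 ω (leg12 X) = (sliceL ω X).rTensor H := by
  induction X using end_tensor_induction with
  | add X X' hX hY => simp only [leg12_add, map_add, hX, hY, LinearMap.rTensor_add]
  | map a b => simp [rTensor_eq_map]

theorem slice1_leg13 : slice1 ω (leg13 X) = (sliceL ω X).lTensor H := by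
  induction X using end_tensor_induction with
  | add X X' hX hY => simp only [leg13_add, map_add, hX, hY, LinearMap.lTensor_add]
  | map a b => simp [lTensor_eq_map]

theorem eq_of_slice3 {S T : Module.End ℂ (H ⊗[ℂ] (H ⊗[ℂ] H))}
    (h : ∀ ω, slice3 ω S = slice3 ω T) : S = T :=
  (TensorProduct.assoc ℂ H H H).symm.conj.injective (eq_of_sliceR h)

theorem slice3_leg12_mul (T : Module.End ℂ (H ⊗[ℂ] (H ⊗[ℂ] H))) :
    slice3 ω (leg12 Y * T) = Y * slice3 ω T := by
  induction T using end_tensor_induction with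
  | add X X' hX hY => simp only [mul_add, map_add, hX, hY]
  | map a b =>
    induction b using end_tensor_induction with
    | add X X' hX hY => simp only [TensorProduct.map_add_right, mul_add, map_add, hX, hY]
    | map b c =>
      induction Y using end_tensor_induction with
      | add X X' hX hY => simp only [leg12_add, add_mul, map_add, hX, hY]
      | map d e => simp [map_mul_map]

theorem slice3_mul_leg12 (T : Module.End ℂ (H ⊗[ℂ] (H ⊗[ℂ] H))) :
    slice3 ω (T * leg12 Y) = slice3 ω T * Y := by
  induction T using end_tensor_induction with
  | add X X' hX hY => simp only [add_mul, map_add, hX, hY]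
  | map a b =>
    induction b using end_tensor_induction with
    | add X X' hX hY => simp only [TensorProduct.map_add_right, add_mul, map_add, hX, hY]
    | map b c =>
      induction Y using end_tensor_induction with
      | add X X' hX hY => simp only [leg12_add, mul_add, map_add, hX, hY]
      | map d e => simp [map_mul_map]

theorem slice3_leg23 : slice3 ω (leg23 X) = (sliceR ω X).lTensor H := by
  induction X using end_tensor_induction with
  | add X X' hX hY => simp only [leg23_add, map_add, hX, hY, LinearMap.lTensor_add]
  | map a b => simp [lTensor_eq_map]

theorem slice3_leg13 : slice3 ω (leg13 X) = (sliceR ω X).rTensor H := by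
  induction X using end_tensor_induction with
  | add X X' hX hY => simp only [leg13_add, map_add, hX, hY, LinearMap.rTensor_add]
  | map a b => simp [rTensor_eq_map]

/-- Where two factors share a leg, slicing the other leg of one of them leaves an operator in the
shared leg, which is absorbed into the functional there. This and the next two formulas convert leg
identities into statements about functionals. -/
theorem sliceR_slice1_leg12_mul_leg13 : sliceR k (slice1 ω (leg12 X * leg13 Y)) =
    sliceL (ω ∘ₗ LinearMap.mulRight ℂ (sliceR k Y)) X := by
  induction X using end_tensor_induction with
  | add X X' hX hY => simp only [leg12_add, add_mul, map_add, hX, hY]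
  | map a b =>
    induction Y using end_tensor_induction with
    | add X X' hX hY =>
      simp only [leg13_add, mul_add, map_add, hX, hY, comp_mulRight_add, sliceL_add_left]
    | map c d => simp [map_mul_map, smul_smul, mul_comm]

theorem sliceL_slice1_leg12_mul_leg13 : sliceL k (slice1 ω (leg12 X * leg13 Y)) =
    sliceL (ω ∘ₗ LinearMap.mulLeft ℂ (sliceR k X)) Y := by
  induction X using end_tensor_induction with
  | add X X' hX hY =>
    simp only [leg12_add, add_mul, map_add, hX, hY, comp_mulLeft_add, sliceL_add_left]
  | map a b =>
    induction Y using end_tensor_induction with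
    | add X X' hX hY => simp only [leg13_add, mul_add, map_add, hX, hY]
    | map c d => simp [map_mul_map, smul_smul, mul_comm]

theorem sliceL_slice3_leg13_mul_leg23 : sliceL k (slice3 ω (leg13 X * leg23 Y)) =
    sliceR (ω ∘ₗ LinearMap.mulLeft ℂ (sliceL k X)) Y := by
  induction X using end_tensor_induction with
  | add X X' hX hY =>
    simp only [leg13_add, add_mul, map_add, hX, hY, comp_mulLeft_add, sliceR_add_left]
  | map a b =>
    induction Y using end_tensor_induction with
    | add X X' hX hY => simp only [leg23_add, mul_add, map_add, hX, hY]
    | map c d => simp [map_mul_map, smul_smul, mul_comm]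

theorem leg23_flip_mul_leg13 : leg23 (flip H) * leg13 X = leg12 X * leg23 (flip H) := by
  have h : leg23 (flip H) * leg13 X * leg23 (flip H) = leg12 X := by
    induction X using end_tensor_induction with
    | add X Y hX hY => simp only [leg13_add, leg12_add, mul_add, add_mul, hX, hY]
    | map a b => rw [leg13_map, leg23_flip_conj_map, leg12_map]
  rw [← h, mul_assoc _ (leg23 (flip H)), leg23_flip_mul_self, mul_one]

theorem flip12_3_mul_leg12 : flip12_3 H * leg12 X = leg23 X * flip12_3 H := by
  induction X using end_tensor_induction with
  | add X Y hX hY => simp only [leg12_add, leg23_add, mul_add, add_mul, hX, hY]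
  | map a b => rw [leg12_map, leg23_map, flip12_3_map]

theorem flip12_3_mul_leg32 : flip12_3 H * leg32 X = leg13 X * flip12_3 H := by
  induction X using end_tensor_induction with
  | add X Y hX hY => simp only [leg32_add, leg13_add, mul_add, add_mul, hX, hY]
  | map a b => rw [leg32_map, leg13_map, flip12_3_map]

end ThreeLegs

/-! ### Adjoints of legs and slices -/

section StarLegs

variable {H : Type*} [NormedAddCommGroup H] [InnerProductSpace ℂ H] [FiniteDimensional ℂ H]

theorem star_map {M N : Type*} [NormedAddCommGroup M] [InnerProductSpace ℂ M]
    [FiniteDimensional ℂ M] [NormedAddCommGroup N] [InnerProductSpace ℂ N]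
    [FiniteDimensional ℂ N] (x : Module.End ℂ M) (y : Module.End ℂ N) :
    star (TensorProduct.map x y) = TensorProduct.map (star x) (star y) :=
  TensorProduct.adjoint_map x y

/-- The adjoint of operators on `M ⊗ N`, for the underlying algebraic structure. -/
instance instStarRingEndTensor {M N : Type*} [NormedAddCommGroup M] [InnerProductSpace ℂ M]
    [FiniteDimensional ℂ M] [NormedAddCommGroup N] [InnerProductSpace ℂ N]
    [FiniteDimensional ℂ N] : StarRing (Module.End ℂ (M ⊗[ℂ] N)) :=
  @LinearMap.instStarRingId ℂ (M ⊗[ℂ] N) _ _ _ _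

instance instStarRingEndTensorTensor :
    StarRing (Module.End ℂ (H ⊗[ℂ] (H ⊗[ℂ] H))) :=
  @LinearMap.instStarRingId ℂ (H ⊗[ℂ] (H ⊗[ℂ] H)) _ _ _ _

theorem star_mul_tensor (X Y : Module.End ℂ (H ⊗[ℂ] H)) : star (X * Y) = star Y * star X :=
  star_mul X Y

theorem star_add_tensor (X Y : Module.End ℂ (H ⊗[ℂ] H)) : star (X + Y) = star X + star Y :=
  star_add X Y

theorem star_lTensor (x : Module.End ℂ H) : star (x.lTensor H) = (star x).lTensor H := by
  rw [lTensor_eq_map, star_map, star_one, lTensor_eq_map]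

theorem star_rTensor (x : Module.End ℂ H) : star (x.rTensor H) = (star x).rTensor H := by
  rw [rTensor_eq_map, star_map, star_one, rTensor_eq_map]

theorem star_leg12 (X : Module.End ℂ (H ⊗[ℂ] H)) : star (leg12 X) = leg12 (star X) := by
  induction X using end_tensor_induction with
  | add X Y hX hY => rw [leg12_add, star_add, hX, hY, star_add_tensor, leg12_add]
  | map a b => simp [star_map]

theorem star_leg23 (X : Module.End ℂ (H ⊗[ℂ] H)) : star (leg23 X) = leg23 (star X) := by
  induction X using end_tensor_induction with
  | add X Y hX hY => rw [leg23_add, star_add, hX, hY, star_add_tensor, leg23_add]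
  | map a b => simp [star_map]

theorem star_leg13 (X : Module.End ℂ (H ⊗[ℂ] H)) : star (leg13 X) = leg13 (star X) := by
  induction X using end_tensor_induction with
  | add X Y hX hY => rw [leg13_add, star_add, hX, hY, star_add_tensor, leg13_add]
  | map a b => simp [star_map]

/-- The functional `x ↦ conj (ω (x*))`. -/
def starDual (ω : Module.Dual ℂ (Module.End ℂ H)) : Module.Dual ℂ (Module.End ℂ H) where
  toFun x := star (ω (star x))
  map_add' x y := by simp
  map_smul' a x := by simp

@[simp] theorem starDual_apply (ω : Module.Dual ℂ (Module.End ℂ H)) (x : Module.End ℂ H) :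
    starDual ω x = star (ω (star x)) := rfl

theorem star_sliceL (ω : Module.Dual ℂ (Module.End ℂ H)) (X : Module.End ℂ (H ⊗[ℂ] H)) :
    star (sliceL ω X) = sliceL (starDual ω) (star X) := by
  induction X using end_tensor_induction with
  | add X Y hX hY => simp only [map_add, star_add, hX, hY]
  | map a b => simp [star_map]

theorem star_sliceR (ω : Module.Dual ℂ (Module.End ℂ H)) (X : Module.End ℂ (H ⊗[ℂ] H)) :
    star (sliceR ω X) = sliceR (starDual ω) (star X) := by
  induction X using end_tensor_induction with
  | add X Y hX hY => simp only [map_add, star_add, hX, hY]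
  | map a b => simp [star_map]

theorem star_mem_rightLeg {X : Module.End ℂ (H ⊗[ℂ] H)} (hX : star X = X) {y : Module.End ℂ H}
    (hy : y ∈ rightLeg X) : star y ∈ rightLeg X := by
  obtain ⟨ω, rfl⟩ := hy
  exact ⟨starDual ω, by conv_lhs => rw [← hX]
                        exact (star_sliceL ω X).symm⟩

theorem star_mem_leftLeg {X : Module.End ℂ (H ⊗[ℂ] H)} (hX : star X = X) {y : Module.End ℂ H}
    (hy : y ∈ leftLeg X) : star y ∈ leftLeg X := by
  obtain ⟨ω, rfl⟩ := hy
  exact ⟨starDual ω, by conv_lhs => rw [← hX]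
                        exact (star_sliceR ω X).symm⟩

theorem star_range_proj (V : Module.End ℂ (H ⊗[ℂ] H)) : star (V * star V) = V * star V := by
  rw [star_mul_tensor, star_star]

theorem star_domain_proj (V : Module.End ℂ (H ⊗[ℂ] H)) : star (star V * V) = star V * V := by
  rw [star_mul_tensor, star_star]

end StarLegs

/-! ### Exchange relations from the axioms -/

namespace IsMPI

variable {H : Type*} [NormedAddCommGroup H] [InnerProductSpace ℂ H] [FiniteDimensional ℂ H]
  {V : Module.End ℂ (H ⊗[ℂ] H)}
  (f k ω : Module.Dual ℂ (Module.End ℂ H)) {b c d : Module.End ℂ H}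

theorem star_mul_range_proj (hV : IsMPI V) : star V * (V * star V) = star V := by
  have := congrArg star hV.partial_isometry
  rwa [star_mul_tensor, star_mul_tensor, star_star] at this

theorem range_proj_idem (hV : IsMPI V) : V * star V * (V * star V) = V * star V := by
  rw [mul_assoc, hV.star_mul_range_proj]

theorem domain_proj_idem (hV : IsMPI V) : star V * V * (star V * V) = star V * V := by
  rw [mul_assoc, ← mul_assoc V, hV.partial_isometry]

theorem leg13_mul_range (hV : IsMPI V) :
    leg13 V * leg23 (V * star V) = leg12 (star V * V) * leg13 V := by
  rw [leg23_mul, leg12_mul, ← mul_assoc, hV.range_left]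

/-- The middle slice of V₁₃E₂₃ = F₁₂V₁₃. It pairs each element of A^L with an element of the left
leg of F, which will be its image under α₁₂. -/
theorem mul_lTensor_slice (hV : IsMPI V) :
    V * (sliceL f (V * star V)).lTensor H = (sliceR f (star V * V)).rTensor H * V := by
  rw [← slice2_leg13_mul_leg23, hV.leg13_mul_range, slice2_leg12_mul_leg13]

theorem commute_rTensor (hV : IsMPI V) (hb : b ∈ rightLeg (V * star V)) :
    Commute (b.rTensor H) V := by
  obtain ⟨f, rfl⟩ := hb
  have := congrArg (slice1 f) hV.range_commute
  rw [← leg12_mul, mul_assoc (leg23 V), ← leg12_mul, slice1_leg12_mul_leg23, slice1_leg23_mul,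
    slice1_leg12] at this
  exact this

theorem commute_lTensor (hV : IsMPI V) (hd : d ∈ leftLeg (star V * V)) :
    Commute (d.lTensor H) V := by
  obtain ⟨f, rfl⟩ := hd
  have := congrArg (slice3 f) hV.domain_commute
  rw [← leg23_mul, mul_assoc (leg12 V), ← leg23_mul, slice3_leg12_mul, slice3_mul_leg12,
    slice3_leg23] at this
  exact this.symm

theorem commute_rTensor_star (hV : IsMPI V) (hb : b ∈ rightLeg (V * star V)) :
    Commute (b.rTensor H) (star V) := by
  have := (hV.commute_rTensor (star_mem_rightLeg (star_range_proj V) hb)).star_star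
  rwa [star_rTensor, star_star] at this

theorem commute_lTensor_star (hV : IsMPI V) (hd : d ∈ leftLeg (star V * V)) :
    Commute (d.lTensor H) (star V) := by
  have := (hV.commute_lTensor (star_mem_leftLeg (star_domain_proj V) hd)).star_star
  rwa [star_lTensor, star_star] at this

theorem commute_right_left (hV : IsMPI V) (hb : b ∈ rightLeg (V * star V))
    (hc : c ∈ leftLeg (V * star V)) : Commute b c :=
  commute_rTensor_iff.1 ((hV.commute_rTensor hb).mul_right (hV.commute_rTensor_star hb)) c hc

theorem commute_right_domain (hV : IsMPI V) (hb : b ∈ rightLeg (V * star V))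
    (hd : d ∈ leftLeg (star V * V)) : Commute b d :=
  commute_rTensor_iff.1 ((hV.commute_rTensor_star hb).mul_right (hV.commute_rTensor hb)) d hd

/-- The pentagon multiplied by V₂₃* on the right: V₁₃E₂₃ = F₁₂V₁₃, and V₁₂ absorbs F₁₂. The next
lemma is the mirror image. -/
theorem leg12_mul_leg13 (hV : IsMPI V) :
    leg12 V * leg13 V = leg23 V * leg12 V * leg23 (star V) := by
  rw [hV.pentagon, mul_assoc _ (leg23 V), ← leg23_mul, mul_assoc, hV.leg13_mul_range, ← mul_assoc,
    ← leg12_mul, ← mul_assoc, hV.partial_isometry]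

theorem leg13_mul_leg23 (hV : IsMPI V) :
    leg13 V * leg23 V = leg12 (star V) * leg23 V * leg12 V := by
  rw [mul_assoc (leg12 (star V)), hV.pentagon, ← mul_assoc, ← mul_assoc, ← leg12_mul,
    ← hV.leg13_mul_range, mul_assoc, ← leg23_mul, hV.partial_isometry]

/-- The left side is TT* for T = V₁₂V₁₃ = V₂₃V₁₂V₂₃*; in TT* the commutation axioms move F₂₃ and
then E₁₂ to the left, where V₂₃ absorbs F₂₃. -/
theorem leg12_range_conj (hV : IsMPI V) :
    leg12 V * leg13 (V * star V) * leg12 (star V) = leg12 (V * star V) * leg23 (V * star V) := by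
  have h1 : leg12 V * leg23 (star V * V) = leg23 (star V * V) * leg12 V := by
    rw [leg23_mul, ← mul_assoc, hV.domain_commute]
  have h2 : leg12 (V * star V) * leg23 V = leg23 V * leg12 (V * star V) := by
    rw [leg12_mul, hV.range_commute, mul_assoc]
  calc leg12 V * leg13 (V * star V) * leg12 (star V)
      = (leg12 V * leg13 V) * star (leg12 V * leg13 V) := by
        rw [star_mul, star_leg12, star_leg13, leg13_mul]; simp only [mul_assoc]
    _ = leg23 V * (leg12 V * leg23 (star V * V)) * leg12 (star V) * leg23 (star V) := by
        rw [hV.leg12_mul_leg13, star_mul, star_mul, star_leg12, star_leg23, star_leg23, star_star,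
          leg23_mul]
        simp only [mul_assoc]
    _ = leg23 V * leg12 (V * star V) * leg23 (star V) := by
        rw [h1, ← mul_assoc, ← leg23_mul, ← mul_assoc V, hV.partial_isometry, leg12_mul]
        simp only [mul_assoc]
    _ = leg12 (V * star V) * leg23 (V * star V) := by
        rw [← h2, leg23_mul, mul_assoc]

end IsMPI

/-! ### Units, the legs of the two projections, and the algebra A^L -/

namespace IsUnitalBy

variable {H : Type*} [NormedAddCommGroup H] [InnerProductSpace ℂ H] [FiniteDimensional ℂ H]
  {V : Module.End ℂ (H ⊗[ℂ] H)} {ε εhat : Module.Dual ℂ (Module.End ℂ H)}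
  (f k ω : Module.Dual ℂ (Module.End ℂ H)) {b c d x y : Module.End ℂ H}

theorem lTensor_mul (hu : IsUnitalBy V ε εhat) : (sliceL εhat V).lTensor H * V = V :=
  eq_of_sliceL fun ω => by rw [sliceL_lTensor_mul]; exact (hu.unit_right_leg ω).1

theorem mul_lTensor (hu : IsUnitalBy V ε εhat) : V * (sliceL εhat V).lTensor H = V :=
  eq_of_sliceL fun ω => by rw [sliceL_mul_lTensor]; exact (hu.unit_right_leg ω).2

theorem rTensor_mul (hu : IsUnitalBy V ε εhat) : (sliceR ε V).rTensor H * V = V :=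
  eq_of_sliceR fun ω => by rw [sliceR_rTensor_mul]; exact (hu.unit_left_leg ω).1

theorem mul_rTensor (hu : IsUnitalBy V ε εhat) : V * (sliceR ε V).rTensor H = V :=
  eq_of_sliceR fun ω => by rw [sliceR_mul_rTensor]; exact (hu.unit_left_leg ω).2

theorem unit_mul_rightLeg (hu : IsUnitalBy V ε εhat) (hx : x ∈ rightLeg V) :
    sliceL εhat V * x = x := by
  obtain ⟨ω, rfl⟩ := hx; exact (hu.unit_right_leg ω).1

theorem rightLeg_mul_unit (hu : IsUnitalBy V ε εhat) (hx : x ∈ rightLeg V) :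
    x * sliceL εhat V = x := by
  obtain ⟨ω, rfl⟩ := hx; exact (hu.unit_right_leg ω).2

theorem unit_mul_leftLeg (hu : IsUnitalBy V ε εhat) (hx : x ∈ leftLeg V) :
    sliceR ε V * x = x := by
  obtain ⟨ω, rfl⟩ := hx; exact (hu.unit_left_leg ω).1

/-- Apply ε̂ ⊗ id to V(1 ⊗ b) = (d ⊗ 1)V: one side becomes λ(ε̂)b, and λ(ε̂) acts trivially because
it fixes V. This places A^L inside the right leg of V. -/
theorem sliceL_range_eq (hV : IsMPI V) (hu : IsUnitalBy V ε εhat) :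
    sliceL f (V * star V) =
      sliceL (εhat ∘ₗ LinearMap.mulLeft ℂ (sliceR f (star V * V))) V := by
  rw [← sliceL_rTensor_mul, ← hV.mul_lTensor_slice, sliceL_mul_lTensor, ← sliceL_lTensor_mul,
    ← mul_assoc, hu.lTensor_mul]

theorem sliceR_domain_eq (hV : IsMPI V) (hu : IsUnitalBy V ε εhat) :
    sliceR f (star V * V) =
      sliceR (ε ∘ₗ LinearMap.mulRight ℂ (sliceL f (V * star V))) V := by
  rw [← sliceR_mul_lTensor, hV.mul_lTensor_slice, sliceR_rTensor_mul, ← sliceR_mul_rTensor,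
    mul_assoc, hu.mul_rTensor]

/-- The transpose of `sliceL_range_eq`. With its mirror image below it identifies the left leg of E
with the right leg of F. -/
theorem sliceR_range_eq (hV : IsMPI V) (hu : IsUnitalBy V ε εhat) :
    sliceR k (V * star V) =
      sliceL (εhat ∘ₗ LinearMap.mulRight ℂ (sliceR k V)) (star V * V) := by
  refine dual_ext fun f => ?_
  rw [apply_sliceR, sliceL_range_eq f hV hu, ← apply_sliceR, ← apply_sliceR]
  simp

theorem sliceL_domain_eq (hV : IsMPI V) (hu : IsUnitalBy V ε εhat) :
    sliceL k (star V * V) =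
      sliceR (ε ∘ₗ LinearMap.mulLeft ℂ (sliceL k V)) (V * star V) := by
  refine dual_ext fun f => ?_
  rw [← apply_sliceR, sliceR_domain_eq f hV hu, apply_sliceR, apply_sliceR]
  simp

theorem range_right_mem (hV : IsMPI V) (hu : IsUnitalBy V ε εhat)
    (hb : b ∈ rightLeg (V * star V)) : b ∈ rightLeg V := by
  obtain ⟨f, rfl⟩ := hb; exact ⟨_, (sliceL_range_eq f hV hu).symm⟩

theorem domain_left_mem (hV : IsMPI V) (hu : IsUnitalBy V ε εhat)
    (hd : d ∈ leftLeg (star V * V)) : d ∈ leftLeg V := by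
  obtain ⟨f, rfl⟩ := hd; exact ⟨_, (sliceR_domain_eq f hV hu).symm⟩

theorem rightLeg_domain (hV : IsMPI V) (hu : IsUnitalBy V ε εhat) :
    rightLeg (star V * V) = leftLeg (V * star V) := by
  apply le_antisymm
  · rintro _ ⟨k, rfl⟩; exact ⟨_, (sliceL_domain_eq k hV hu).symm⟩
  · rintro _ ⟨k, rfl⟩; exact ⟨_, (sliceR_range_eq k hV hu).symm⟩

/-- The right leg of E is self-adjoint with right unit p = λ(ε̂), so p* is a left unit for it and
fixes V. Slicing gives p*p = p. -/
theorem star_unit_right (hV : IsMPI V) (hu : IsUnitalBy V ε εhat) :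
    star (sliceL εhat V) = sliceL εhat V := by
  have h1 : (star (sliceL εhat V)).lTensor H * (V * star V) = V * star V := by
    refine eq_of_sliceL fun f => ?_
    rw [sliceL_lTensor_mul]
    have hb := star_mem_rightLeg (star_range_proj V) (sliceL_mem_rightLeg f (V * star V))
    have := congrArg star (hu.rightLeg_mul_unit (hu.range_right_mem hV hb))
    rwa [star_mul, star_star] at this
  have h2 : (star (sliceL εhat V)).lTensor H * V = V := by
    have := congrArg (· * V) h1
    simpa only [mul_assoc, ← mul_assoc V, hV.partial_isometry] using this
  have h3 : star (sliceL εhat V) * sliceL εhat V = sliceL εhat V := by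
    rw [← sliceL_lTensor_mul, h2]
  have h4 := congrArg star h3
  rw [star_mul, star_star, h3] at h4
  exact h4.symm

theorem star_unit_left (hV : IsMPI V) (hu : IsUnitalBy V ε εhat) :
    star (sliceR ε V) = sliceR ε V := by
  have h1 : star V * V * (star (sliceR ε V)).rTensor H = star V * V := by
    refine eq_of_sliceR fun f => ?_
    rw [sliceR_mul_rTensor]
    have hb := star_mem_leftLeg (star_domain_proj V) (sliceR_mem_leftLeg f (star V * V))
    have := congrArg star (hu.unit_mul_leftLeg (hu.domain_left_mem hV hb))
    rwa [star_mul, star_star] at this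
  have h2 : V * (star (sliceR ε V)).rTensor H = V := by
    have := congrArg (V * ·) h1
    simpa only [← mul_assoc, hV.partial_isometry] using this
  have h3 : sliceR ε V * star (sliceR ε V) = sliceR ε V := by
    rw [← sliceR_mul_rTensor, h2]
  have h4 := congrArg star h3
  rw [star_mul, star_star, h3] at h4
  exact h4.symm

theorem domain_mul_lTensor (hu : IsUnitalBy V ε εhat) :
    star V * V * (sliceL εhat V).lTensor H = star V * V := by
  rw [mul_assoc, hu.mul_lTensor]

theorem lTensor_mul_domain (hV : IsMPI V) (hu : IsUnitalBy V ε εhat) :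
    (sliceL εhat V).lTensor H * (star V * V) = star V * V := by
  have := congrArg star hu.domain_mul_lTensor
  rwa [star_mul_tensor, star_domain_proj, star_lTensor, star_unit_right hV hu] at this

/-- The two units coincide. -/
theorem unit_eq (hV : IsMPI V) (hu : IsUnitalBy V ε εhat) :
    sliceL εhat V = sliceR ε V := by
  -- λ(ε̂) is a left unit on the right leg of F, which is also the left leg of E, so it fixes V from
  -- the first factor as well. Symmetrically ρ(ε) fixes V from the second factor, and λ(ε̂)ρ(ε)
  -- equals each of the two.
  have h1 : (sliceL εhat V).rTensor H * V = V := by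
    have : (sliceL εhat V).rTensor H * (V * star V) = V * star V := by
      refine eq_of_sliceR fun k => ?_
      rw [sliceR_rTensor_mul]
      obtain ⟨f, hf⟩ : sliceR k (V * star V) ∈ rightLeg (star V * V) :=
        rightLeg_domain hV hu ▸ sliceR_mem_leftLeg k _
      rw [← (show sliceL f (star V * V) = sliceR k (V * star V) from hf), ← sliceL_lTensor_mul,
        lTensor_mul_domain hV hu]
    have := congrArg (· * V) this
    simpa only [mul_assoc, ← mul_assoc V, hV.partial_isometry] using this
  have h2 : V * (sliceR ε V).lTensor H = V := by
    have h : (sliceR ε V).lTensor H * (star V * V) = star V * V := by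
      refine eq_of_sliceL fun k => ?_
      rw [sliceL_lTensor_mul]
      obtain ⟨f, hf⟩ : sliceL k (star V * V) ∈ leftLeg (V * star V) :=
        rightLeg_domain hV hu ▸ sliceL_mem_rightLeg k _
      rw [← (show sliceR f (V * star V) = sliceL k (star V * V) from hf), ← sliceR_rTensor_mul,
        ← mul_assoc, hu.rTensor_mul]
    have h := congrArg star h
    rw [star_mul_tensor, star_domain_proj, star_lTensor, star_unit_left hV hu] at h
    have := congrArg (V * ·) h
    simpa only [← mul_assoc, hV.partial_isometry] using this
  have h3 : sliceL εhat V * sliceR ε V = sliceR ε V := by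
    rw [← sliceR_rTensor_mul, h1]
  have h4 : sliceL εhat V * sliceR ε V = sliceL εhat V := by
    rw [← sliceL_mul_lTensor, h2]
  exact h4.symm.trans h3

/-- E is the coproduct of the unit: the slice is V(λ(ε̂) ⊗ 1)V*, and λ(ε̂) = ρ(ε) is absorbed by V.
-/
theorem range_proj_eq_slice (hV : IsMPI V) (hu : IsUnitalBy V ε εhat) :
    V * star V = slice1 εhat (leg12 V * leg13 V) := by
  rw [hV.leg12_mul_leg13, slice1_mul_leg23, slice1_leg23_mul, slice1_leg12, unit_eq hV hu,
    hu.mul_rTensor]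

theorem domain_proj_eq_slice (hV : IsMPI V) (hu : IsUnitalBy V ε εhat) :
    star V * V = slice3 ε (leg13 V * leg23 V) := by
  rw [hV.leg13_mul_leg23, slice3_mul_leg12, slice3_leg12_mul, slice3_leg23, ← unit_eq hV hu,
    mul_assoc, hu.lTensor_mul]

theorem sliceR_range_eq' (hV : IsMPI V) (hu : IsUnitalBy V ε εhat) :
    sliceR k (V * star V) = sliceL (εhat ∘ₗ LinearMap.mulRight ℂ (sliceR k V)) V := by
  rw [range_proj_eq_slice hV hu, sliceR_slice1_leg12_mul_leg13]

theorem sliceL_domain_eq' (hV : IsMPI V) (hu : IsUnitalBy V ε εhat) :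
    sliceL k (star V * V) = sliceR (ε ∘ₗ LinearMap.mulLeft ℂ (sliceL k V)) V := by
  rw [domain_proj_eq_slice hV hu, sliceL_slice3_leg13_mul_leg23]

theorem range_left_mem (hV : IsMPI V) (hu : IsUnitalBy V ε εhat)
    (hc : c ∈ leftLeg (V * star V)) : c ∈ rightLeg V := by
  obtain ⟨f, rfl⟩ := hc; exact ⟨_, (sliceR_range_eq' f hV hu).symm⟩

theorem range_left_mem_left (hV : IsMPI V) (hu : IsUnitalBy V ε εhat)
    (hc : c ∈ leftLeg (V * star V)) : c ∈ leftLeg V := by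
  rw [← rightLeg_domain hV hu] at hc
  obtain ⟨f, rfl⟩ := hc; exact ⟨_, (sliceL_domain_eq' f hV hu).symm⟩

theorem commute_left_domain (hV : IsMPI V) (hu : IsUnitalBy V ε εhat)
    (hc : c ∈ leftLeg (V * star V)) (hd : d ∈ leftLeg (star V * V)) : Commute c d := by
  rw [← rightLeg_domain hV hu] at hc
  exact (commute_lTensor_iff.1
    ((hV.commute_lTensor_star hd).mul_right (hV.commute_lTensor hd)) c hc).symm

/-- The third slice of V₁₂E₁₃V₁₂* = E₁₂E₂₃ is V(c ⊗ 1)V* = E(1 ⊗ c); the V* is removed because c ⊗ 1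
commutes with F and 1 ⊗ c with E. -/
theorem mul_rTensor_left (hV : IsMPI V) (hu : IsUnitalBy V ε εhat)
    (hc : c ∈ leftLeg (V * star V)) : V * c.rTensor H = c.lTensor H * V := by
  have h1 : V * c.rTensor H * star V = V * star V * c.lTensor H := by
    obtain ⟨f, rfl⟩ := hc
    have := congrArg (slice3 f) hV.leg12_range_conj
    rwa [slice3_mul_leg12, slice3_leg12_mul, slice3_leg13, slice3_leg12_mul, slice3_leg23] at this
  have h2 : Commute (c.rTensor H) (star V * V) :=
    commute_rTensor_iff.2 fun d hd => commute_left_domain hV hu hc hd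
  have h3 : Commute (c.lTensor H) (V * star V) :=
    commute_lTensor_iff.2 fun b hb => (hV.commute_right_left hb hc).symm
  calc V * c.rTensor H = V * star V * V * c.rTensor H := by rw [hV.partial_isometry]
    _ = V * c.rTensor H * star V * V := by
      rw [mul_assoc V, mul_assoc V, ← h2.eq]; simp only [mul_assoc]
    _ = c.lTensor H * V := by rw [h1, ← h3.eq, mul_assoc, hV.partial_isometry]

/-- The right leg is an algebra. -/
theorem rightLeg_mul_mem (hV : IsMPI V) (hx : x ∈ rightLeg V) (hy : y ∈ rightLeg V) :
    x * y ∈ rightLeg V := by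
  obtain ⟨k, rfl⟩ := hx
  obtain ⟨k', rfl⟩ := hy
  -- The product is dual to the coproduct y ↦ V*(1 ⊗ y)V, by V₁₃V₂₃ = V₁₂*V₂₃V₁₂.
  refine ⟨k' ∘ₗ sliceL k ∘ₗ LinearMap.mulLeft ℂ (star V) ∘ₗ LinearMap.mulRight ℂ V ∘ₗ
    LinearMap.lTensorHom H, dual_ext fun f => ?_⟩
  have h : f (sliceL k V * sliceL k' V) = k' (sliceL k (slice3 f (leg13 V * leg23 V))) := by
    rw [sliceL_slice3_leg13_mul_leg23, apply_sliceR]; simp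
  change f (sliceL _ V) = f (sliceL k V * sliceL k' V)
  rw [h, hV.leg13_mul_leg23, slice3_mul_leg12, slice3_leg12_mul, slice3_leg23, ← apply_sliceR]
  simp [mul_assoc]

/-- By commutation (x ⊗ 1)E = V(x ⊗ 1)V*, the coproduct of x = λ(ω), which is (ω ⊗ id ⊗ id)(V₁₂V₁₃);
ε in its first leg turns V₁₂ into the unit ρ(ε). -/
theorem slice_range_of_commute (hV : IsMPI V) (hu : IsUnitalBy V ε εhat)
    (hx : x ∈ rightLeg V) (h : Commute (x.rTensor H) V) :
    sliceL (ε ∘ₗ LinearMap.mulLeft ℂ x) (V * star V) = x := by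
  obtain ⟨ω, hω⟩ := hx
  change sliceL ω V = x at hω
  rw [← sliceL_rTensor_mul, ← mul_assoc, h.eq, ← hω, ← slice1_leg12, ← slice1_leg23_mul,
    ← slice1_mul_leg23, ← hV.leg12_mul_leg13, sliceL_slice1_leg12_mul_leg13,
    ← sliceL_rTensor_mul, hu.rTensor_mul]

/-- Characterisation of the left subalgebra inside the right leg. -/
theorem mem_range_right_iff (hV : IsMPI V) (hu : IsUnitalBy V ε εhat) :
    x ∈ rightLeg (V * star V) ↔ x ∈ rightLeg V ∧ Commute (x.rTensor H) V :=
  ⟨fun h => ⟨range_right_mem hV hu h, hV.commute_rTensor h⟩,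
    fun h => ⟨_, slice_range_of_commute hV hu h.1 h.2⟩⟩

theorem range_right_mul_mem (hV : IsMPI V) (hu : IsUnitalBy V ε εhat)
    (hx : x ∈ rightLeg (V * star V)) (hy : y ∈ rightLeg (V * star V)) :
    x * y ∈ rightLeg (V * star V) := by
  rw [mem_range_right_iff hV hu] at *
  refine ⟨rightLeg_mul_mem hV hx.1 hy.1, ?_⟩
  rw [LinearMap.rTensor_mul]
  exact hx.2.mul_left hy.2

theorem unit_mem_range_right (hV : IsMPI V) (hu : IsUnitalBy V ε εhat) :
    sliceL εhat V ∈ rightLeg (V * star V) := by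
  rw [mem_range_right_iff hV hu]
  refine ⟨sliceL_mem_rightLeg _ _, ?_⟩
  rw [unit_eq hV hu]
  exact hu.rTensor_mul.trans hu.mul_rTensor.symm

end IsUnitalBy

/-! ### The source and target maps and the nondegeneracy of the counit -/

section Maps

variable {H : Type*} [NormedAddCommGroup H] [InnerProductSpace ℂ H] [FiniteDimensional ℂ H]

/-- The map `x ↦ (id ⊗ ε)(V (1 ⊗ x))`. -/
def sourceMap (V : Module.End ℂ (H ⊗[ℂ] H)) (ε : Module.Dual ℂ (Module.End ℂ H)) :
    Module.End ℂ H →ₗ[ℂ] Module.End ℂ H :=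
  sliceR ε ∘ₗ LinearMap.mulLeft ℂ V ∘ₗ LinearMap.lTensorHom H

/-- The map `x ↦ (id ⊗ ε)((1 ⊗ x) V)`. -/
def targetMap (V : Module.End ℂ (H ⊗[ℂ] H)) (ε : Module.Dual ℂ (Module.End ℂ H)) :
    Module.End ℂ H →ₗ[ℂ] Module.End ℂ H :=
  sliceR ε ∘ₗ LinearMap.mulRight ℂ V ∘ₗ LinearMap.lTensorHom H

variable (V : Module.End ℂ (H ⊗[ℂ] H)) (ε : Module.Dual ℂ (Module.End ℂ H))
  (x : Module.End ℂ H)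

theorem sourceMap_apply : sourceMap V ε x = sliceR ε (V * x.lTensor H) := rfl

theorem targetMap_apply : targetMap V ε x = sliceR ε (x.lTensor H * V) := rfl

theorem apply_targetMap (f : Module.Dual ℂ (Module.End ℂ H)) :
    f (targetMap V ε x) = ε (x * sliceL f V) := by
  rw [targetMap_apply, apply_sliceR, sliceL_lTensor_mul]

end Maps

namespace IsUnitalBy

variable {H : Type*} [NormedAddCommGroup H] [InnerProductSpace ℂ H] [FiniteDimensional ℂ H]
  {V : Module.End ℂ (H ⊗[ℂ] H)} {ε εhat : Module.Dual ℂ (Module.End ℂ H)}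
  (f k ω : Module.Dual ℂ (Module.End ℂ H)) {b c d x y : Module.End ℂ H}

theorem sourceMap_slice (hV : IsMPI V) (hu : IsUnitalBy V ε εhat) :
    sourceMap V ε (sliceL f (V * star V)) = sliceR f (star V * V) := by
  rw [sourceMap_apply, sliceR_mul_lTensor, ← sliceR_domain_eq f hV hu]

theorem mul_lTensor_right (hV : IsMPI V) (hu : IsUnitalBy V ε εhat)
    (hb : b ∈ rightLeg (V * star V)) :
    V * b.lTensor H = (sourceMap V ε b).rTensor H * V := by
  obtain ⟨f, rfl⟩ := hb
  change V * (sliceL f (V * star V)).lTensor H =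
    (sourceMap V ε (sliceL f (V * star V))).rTensor H * V
  rw [sourceMap_slice f hV hu, hV.mul_lTensor_slice]

/-- Well-definedness of α₁₂: tested against f, the slice of F is ε(λ(f)λ(ω)), which depends on ω
only through λ(ω). -/
theorem sliceR_domain_eq_sourceMap (hV : IsMPI V) (hu : IsUnitalBy V ε εhat)
    (h : sliceL ω V = x) : sliceR ω (star V * V) = sourceMap V ε x := by
  refine dual_ext fun f => ?_
  rw [apply_sliceR, sliceL_domain_eq' f hV hu, apply_sliceR, h, sourceMap_apply, apply_sliceR,
    sliceL_mul_lTensor]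
  simp

theorem sourceMap_mem (hV : IsMPI V) (hu : IsUnitalBy V ε εhat)
    (hb : b ∈ rightLeg (V * star V)) : sourceMap V ε b ∈ leftLeg (star V * V) := by
  obtain ⟨f, rfl⟩ := hb
  exact ⟨f, (sourceMap_slice f hV hu).symm⟩

theorem sourceMap_unit (hu : IsUnitalBy V ε εhat) :
    sourceMap V ε (sliceL εhat V) = sliceR ε V := by
  rw [sourceMap_apply, hu.mul_lTensor]

theorem sourceMap_mul (hV : IsMPI V) (hu : IsUnitalBy V ε εhat)
    (hb : b ∈ rightLeg (V * star V)) (x : Module.End ℂ H) :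
    sourceMap V ε (b * x) = sourceMap V ε b * sourceMap V ε x := by
  rw [sourceMap_apply, LinearMap.lTensor_mul, ← mul_assoc, mul_lTensor_right hV hu hb, mul_assoc,
    sliceR_rTensor_mul, ← sourceMap_apply]

theorem sourceMap_star (hV : IsMPI V) (hu : IsUnitalBy V ε εhat)
    (hb : b ∈ rightLeg (V * star V)) :
    sourceMap V ε (star b) = star (sourceMap V ε b) := by
  obtain ⟨f, rfl⟩ := hb
  change sourceMap V ε (star (sliceL f (V * star V))) =
    star (sourceMap V ε (sliceL f (V * star V)))
  rw [star_sliceL, star_range_proj, sourceMap_slice _ hV hu, sourceMap_slice _ hV hu, star_sliceR,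
    star_domain_proj]

theorem eq_zero_of_sourceMap (hV : IsMPI V) (hu : IsUnitalBy V ε εhat)
    (hb : b ∈ rightLeg (V * star V)) (h : sourceMap V ε b = 0) : b = 0 := by
  have h1 := mul_lTensor_right hV hu hb
  rw [h, LinearMap.rTensor_zero, zero_mul] at h1
  rw [← hu.unit_mul_rightLeg (range_right_mem hV hu hb), ← sliceL_mul_lTensor, h1, map_zero]

theorem targetMap_slice (hV : IsMPI V) (hu : IsUnitalBy V ε εhat) :
    targetMap V ε (sliceL k V) = sliceL k (star V * V) := by
  rw [targetMap_apply, sliceR_lTensor_mul, ← sliceL_domain_eq' k hV hu]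

theorem piR_eq_targetMap (hV : IsMPI V) (hu : IsUnitalBy V ε εhat) (hx : x ∈ rightLeg V) :
    piR V ε x = targetMap V ε x := by
  obtain ⟨k, rfl⟩ := hx
  change sliceR ε ((sliceL k V).lTensor H * (V * star V)) = targetMap V ε (sliceL k V)
  rw [targetMap_slice k hV hu, sliceL_domain_eq k hV hu, sliceR_lTensor_mul]

theorem apply_targetMap_range (hV : IsMPI V) (hu : IsUnitalBy V ε εhat) (hx : x ∈ rightLeg V) :
    f (targetMap V ε x) = ε (x * sliceL f (V * star V)) := by
  rw [← piR_eq_targetMap hV hu hx]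
  change f (sliceR ε _) = _
  rw [apply_sliceR, sliceL_lTensor_mul]

theorem targetMap_mem (hV : IsMPI V) (hu : IsUnitalBy V ε εhat) (hx : x ∈ rightLeg V) :
    targetMap V ε x ∈ leftLeg (V * star V) := by
  obtain ⟨k, rfl⟩ := hx
  rw [← rightLeg_domain hV hu]
  exact ⟨k, (targetMap_slice k hV hu).symm⟩

theorem targetMap_mul_left (hV : IsMPI V) (hu : IsUnitalBy V ε εhat)
    (hc : c ∈ leftLeg (V * star V)) (x : Module.End ℂ H) :
    targetMap V ε (x * c) = targetMap V ε x * c := by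
  rw [targetMap_apply, LinearMap.lTensor_mul, mul_assoc, ← mul_rTensor_left hV hu hc, ← mul_assoc,
    sliceR_mul_rTensor, ← targetMap_apply]

theorem targetMap_unit (hu : IsUnitalBy V ε εhat) :
    targetMap V ε (sliceL εhat V) = sliceR ε V := by
  rw [targetMap_apply, hu.lTensor_mul]

theorem targetMap_left (hV : IsMPI V) (hu : IsUnitalBy V ε εhat)
    (hc : c ∈ leftLeg (V * star V)) : targetMap V ε c = c := by
  have hcV := range_left_mem_left hV hu hc
  rw [targetMap_apply, ← mul_rTensor_left hV hu hc, sliceR_mul_rTensor, hu.unit_mul_leftLeg hcV]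

/-- `targetMap` sends the right leg into C and fixes C, so it is idempotent there; ε(xλ(ω)) =
ω(S(x)) turns this into the identity. -/
theorem counit_targetMap_mul (hV : IsMPI V) (hu : IsUnitalBy V ε εhat)
    (hx : x ∈ rightLeg V) (hy : y ∈ rightLeg V) :
    ε (targetMap V ε x * y) = ε (x * y) := by
  obtain ⟨ω, rfl⟩ := hy
  change ε (_ * sliceL ω V) = ε (_ * sliceL ω V)
  rw [← apply_targetMap, ← apply_targetMap, targetMap_left hV hu (targetMap_mem hV hu hx)]

/-- For a in the right leg, ε(xya) = ε(S(x)ya) = ε(yS(x)a) = ε(S(y)S(x)a); the order reverses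
because S(x) in C commutes with y in A^L. -/
theorem targetMap_mul (hV : IsMPI V) (hu : IsUnitalBy V ε εhat)
    (hx : x ∈ rightLeg (V * star V)) (hy : y ∈ rightLeg (V * star V)) :
    targetMap V ε (x * y) = targetMap V ε y * targetMap V ε x := by
  have hxA := range_right_mem hV hu hx
  have hyA := range_right_mem hV hu hy
  have hxC := targetMap_mem hV hu hxA
  have hyC := targetMap_mem hV hu hyA
  refine dual_ext fun f => ?_
  have ha := sliceL_mem_rightLeg f V
  rw [apply_targetMap, mul_assoc, ← counit_targetMap_mul hV hu hxA (rightLeg_mul_mem hV hyA ha),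
    ← mul_assoc, ← (hV.commute_right_left hy hxC).eq, mul_assoc,
    ← counit_targetMap_mul hV hu hyA (rightLeg_mul_mem hV (range_left_mem hV hu hxC) ha),
    ← mul_assoc, ← apply_targetMap, targetMap_mul_left hV hu hxC, targetMap_left hV hu hyC]

theorem slice_range_self (hV : IsMPI V) (hu : IsUnitalBy V ε εhat)
    (hx : x ∈ rightLeg (V * star V)) :
    sliceL (ε ∘ₗ LinearMap.mulLeft ℂ x) (V * star V) = x :=
  slice_range_of_commute hV hu (range_right_mem hV hu hx) (hV.commute_rTensor hx)

/-- E is a reproducing kernel for the pairing ε(cb) between C and A^L; nondegeneracy and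
compatibility with adjoints follow. -/
theorem counit_pairing (hV : IsMPI V) (hu : IsUnitalBy V ε εhat)
    (hb : b ∈ rightLeg (V * star V)) : ε (sliceR k (V * star V) * b) = k b := by
  conv_rhs => rw [← slice_range_self hV hu hb]
  rw [← apply_sliceR, ← (hV.commute_right_left hb (sliceR_mem_leftLeg k _)).eq]
  simp

theorem left_eq_zero (hV : IsMPI V) (hu : IsUnitalBy V ε εhat)
    (hc : c ∈ leftLeg (V * star V)) (h : ∀ b ∈ rightLeg (V * star V), ε (c * b) = 0) :
    c = 0 := by
  obtain ⟨k, rfl⟩ := hc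
  refine dual_ext fun f => ?_
  change f (sliceR k (V * star V)) = f 0
  rw [apply_sliceR, ← counit_pairing k hV hu (sliceL_mem_rightLeg f _), map_zero]
  exact h _ (sliceL_mem_rightLeg f _)

theorem eq_zero_of_targetMap (hV : IsMPI V) (hu : IsUnitalBy V ε εhat)
    (hx : x ∈ rightLeg (V * star V)) (h : targetMap V ε x = 0) : x = 0 := by
  have hxA := range_right_mem hV hu hx
  refine dual_ext fun f => ?_
  have hc := sliceR_mem_leftLeg f (V * star V)
  rw [← counit_pairing f hV hu hx, ← (hV.commute_right_left hx hc).eq,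
    ← counit_targetMap_mul hV hu hxA (range_left_mem hV hu hc), h, zero_mul, map_zero, map_zero]

theorem counit_star_mul_star (hV : IsMPI V) (hu : IsUnitalBy V ε εhat)
    (hc : c ∈ leftLeg (V * star V)) (hb : b ∈ rightLeg (V * star V)) :
    ε (star c * star b) = star (ε (c * b)) := by
  obtain ⟨k, rfl⟩ := hc
  change ε (star (sliceR k (V * star V)) * star b) = star (ε (sliceR k (V * star V) * b))
  rw [star_sliceR, star_range_proj, counit_pairing _ hV hu hb,
    counit_pairing _ hV hu (star_mem_rightLeg (star_range_proj V) hb), starDual_apply, star_star]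

theorem unit_mem_left (hV : IsMPI V) (hu : IsUnitalBy V ε εhat) :
    sliceL εhat V ∈ leftLeg (V * star V) := by
  have := targetMap_mem hV hu (sliceL_mem_rightLeg εhat V)
  rwa [hu.targetMap_unit, ← unit_eq hV hu] at this

theorem counit_star (hV : IsMPI V) (hu : IsUnitalBy V ε εhat)
    (hb : b ∈ rightLeg (V * star V)) : ε (star b) = star (ε b) := by
  have h := counit_star_mul_star hV hu (unit_mem_left hV hu) hb
  have hb' := star_mem_rightLeg (star_range_proj V) hb
  rwa [star_unit_right hV hu, hu.unit_mul_rightLeg (range_right_mem hV hu hb),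
    hu.unit_mul_rightLeg (range_right_mem hV hu hb')] at h

theorem right_eq_zero (hV : IsMPI V) (hu : IsUnitalBy V ε εhat)
    (hx : x ∈ rightLeg (V * star V)) (h : ∀ y ∈ rightLeg (V * star V), ε (x * y) = 0) :
    x = 0 := by
  have hxA := range_right_mem hV hu hx
  refine eq_zero_of_targetMap hV hu hx (left_eq_zero hV hu (targetMap_mem hV hu hxA) ?_)
  intro b hb
  rw [counit_targetMap_mul hV hu hxA (range_right_mem hV hu hb), h b hb]

theorem right_eq_zero' (hV : IsMPI V) (hu : IsUnitalBy V ε εhat)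
    (hx : x ∈ rightLeg (V * star V)) (h : ∀ y ∈ rightLeg (V * star V), ε (y * x) = 0) :
    x = 0 := by
  have hs := star_range_proj V
  rw [← star_eq_zero]
  refine right_eq_zero hV hu (star_mem_rightLeg hs hx) fun y hy => ?_
  rw [← star_star y, ← star_mul, counit_star hV hu, h _ (star_mem_rightLeg hs hy), star_zero]
  exact range_right_mul_mem hV hu (star_mem_rightLeg hs hy) hx

/-- After slicing by f, the pairing under ε with any z in A^L gives f(S(x)S(z)) on both sides; ε is
nondegenerate. -/
theorem lTensor_mul_range (hV : IsMPI V) (hu : IsUnitalBy V ε εhat)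
    (hx : x ∈ rightLeg (V * star V)) :
    x.lTensor H * (V * star V) = (targetMap V ε x).rTensor H * (V * star V) := by
  refine eq_of_sliceL fun f => ?_
  rw [sliceL_lTensor_mul, sliceL_rTensor_mul, ← sub_eq_zero]
  have hf := sliceL_mem_rightLeg f (V * star V)
  refine right_eq_zero' hV hu (Submodule.sub_mem _ (range_right_mul_mem hV hu hx hf)
    (sliceL_mem_rightLeg _ _)) fun z hz => ?_
  rw [mul_sub, map_sub, ← mul_assoc,
    ← apply_targetMap_range f hV hu (range_right_mem hV hu (range_right_mul_mem hV hu hz hx)),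
    ← apply_targetMap_range _ hV hu (range_right_mem hV hu hz), targetMap_mul hV hu hz hx]
  simp

/-- If `V V* = ∑ S(bᵢ) ⊗ aᵢ`, then `∑ aᵢ bᵢ` is the unit. -/
theorem sum_mul_eq_unit (hV : IsMPI V) (hu : IsUnitalBy V ε εhat) {ι : Type*} [Fintype ι]
    (a b : ι → Module.End ℂ H) (ha : ∀ i, a i ∈ rightLeg (V * star V))
    (hb : ∀ i, b i ∈ rightLeg (V * star V))
    (hE : V * star V = ∑ i, TensorProduct.map (targetMap V ε (b i)) (a i)) :
    ∑ i, a i * b i = sliceL εhat V := by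
  have hw : ∑ i, a i * b i ∈ rightLeg (V * star V) :=
    Submodule.sum_mem _ fun i _ => range_right_mul_mem hV hu (ha i) (hb i)
  have hp := unit_mem_range_right hV hu
  -- Expand the first factor of E = E·E and move each aᵢ across E as S(aᵢ): the first leg becomes
  -- S(bᵢ)S(aᵢ) = S(aᵢbᵢ).
  have h1 : V * star V = (targetMap V ε (∑ i, a i * b i)).rTensor H * (V * star V) := by
    conv_lhs => rw [← hV.range_proj_idem]
    nth_rewrite 1 [hE]
    rw [Finset.sum_mul, map_sum, ← LinearMap.coe_rTensorHom, map_sum, Finset.sum_mul]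
    refine Finset.sum_congr rfl fun i _ => ?_
    rw [targetMap_mul hV hu (ha i) (hb i), LinearMap.coe_rTensorHom, LinearMap.rTensor_mul, mul_assoc,
      ← lTensor_mul_range hV hu (ha i), rTensor_eq_map, lTensor_eq_map,
      ← mul_assoc (TensorProduct.map _ 1), map_mul_map, mul_one, one_mul]
  have h2 : ∀ c ∈ leftLeg (V * star V), c = targetMap V ε (∑ i, a i * b i) * c := by
    rintro _ ⟨f, rfl⟩
    change sliceR f (V * star V) = _ * sliceR f (V * star V)
    rw [← sliceR_rTensor_mul, ← h1]
  have h3 := h2 _ (unit_mem_left hV hu)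
  have hwC := targetMap_mem hV hu (range_right_mem hV hu hw)
  rw [hu.rightLeg_mul_unit (range_left_mem hV hu hwC)] at h3
  rw [← sub_eq_zero]
  refine eq_zero_of_targetMap hV hu (Submodule.sub_mem _ hw hp) ?_
  rw [map_sub, ← h3, hu.targetMap_unit, unit_eq hV hu, sub_self]

end IsUnitalBy

/-! ### Functional calculus without a unit -/

section Spectral

variable {H : Type*} [NormedAddCommGroup H] [InnerProductSpace ℂ H] [FiniteDimensional ℂ H]

/-- Functional calculus with a function vanishing at zero, inside the non-unital algebra generated
by a symmetric operator. -/
theorem exists_functionalCalculus {m : Module.End ℂ H} (hm : m.IsSymmetric) {f : ℝ → ℝ}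
    (hf : f 0 = 0) (S : NonUnitalSubalgebra ℂ (Module.End ℂ H)) (hS : m ∈ S) :
    ∃ t ∈ S, ∀ i, t (hm.eigenvectorBasis rfl i) =
      (f (hm.eigenvalues rfl i) : ℂ) • hm.eigenvectorBasis rfl i := by
  classical
  -- Zero is adjoined as a node so that the interpolating polynomial has no constant term.
  let s : Finset ℝ := insert 0 (Finset.univ.image (hm.eigenvalues rfl))
  let P : Polynomial ℂ := Lagrange.interpolate s (fun r : ℝ => (r : ℂ)) fun r => (f r : ℂ)
  have hP : ∀ r ∈ s, P.eval (r : ℂ) = f r := fun r hr =>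
    Lagrange.eval_interpolate_at_node _ (fun a _ b _ h => Complex.ofReal_injective h) hr
  obtain ⟨Q, hQ⟩ : Polynomial.X ∣ P := by
    rw [Polynomial.X_dvd_iff, Polynomial.coeff_zero_eq_eval_zero]
    simpa [hf] using hP 0 (Finset.mem_insert_self _ _)
  have hpow : ∀ n, m ^ (n + 1) ∈ S := fun n => by
    induction n with
    | zero => simpa using hS
    | succ n ih => rw [pow_succ]; exact S.mul_mem ih hS
  have hmem : ∀ Q : Polynomial ℂ, m * Polynomial.aeval m Q ∈ S := fun Q => by
    induction Q using Polynomial.induction_on' with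
    | add p q hp hq => rw [map_add, mul_add]; exact S.add_mem hp hq
    | monomial n a =>
      rw [Polynomial.aeval_monomial, ← Algebra.smul_def, mul_smul_comm, ← pow_succ']
      exact SMulMemClass.smul_mem a (hpow n)
  refine ⟨Polynomial.aeval m P, ?_, fun i => ?_⟩
  · rw [hQ, map_mul, Polynomial.aeval_X]
    exact hmem Q
  · rw [Module.End.aeval_apply_of_hasEigenvector (hm.hasEigenvector_eigenvectorBasis rfl i)]
    congr 1
    exact hP _ (Finset.mem_insert_of_mem (Finset.mem_image_of_mem _ (Finset.mem_univ i)))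

theorem star_eq_of_eigenvectorBasis {m : Module.End ℂ H} (hm : m.IsSymmetric) {f : ℝ → ℝ}
    {t : Module.End ℂ H} (ht : ∀ i, t (hm.eigenvectorBasis rfl i) =
      (f (hm.eigenvalues rfl i) : ℂ) • hm.eigenvectorBasis rfl i) : star t = t := by
  symm
  rw [LinearMap.star_eq_adjoint, LinearMap.eq_adjoint_iff_basis
    (hm.eigenvectorBasis rfl).toBasis (hm.eigenvectorBasis rfl).toBasis]
  intro i j
  simp only [OrthonormalBasis.coe_toBasis, ht, inner_smul_left, inner_smul_right,
    orthonormal_iff_ite.1 (hm.eigenvectorBasis rfl).orthonormal]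
  split_ifs with h
  · subst h; simp
  · simp

/-- Fourth roots are taken so that m^{-1/2} has the form c*c with c in the algebra. Since 0⁻¹ = 0 in
ℝ, `u` inverts `t` only on the support of `m`. -/
theorem exists_fourth_root {m : Module.End ℂ H} (hm : m.IsPositive)
    (S : NonUnitalSubalgebra ℂ (Module.End ℂ H)) (hS : m ∈ S) :
    ∃ t ∈ S, ∃ u ∈ S, star t = t ∧ star u = u ∧ t * t * (t * t) = m ∧ t * u = u * t ∧
      m * (t * u) = m := by
  obtain ⟨t, htS, ht⟩ := exists_functionalCalculus hm.isSymmetric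
    (f := fun r => Real.sqrt (Real.sqrt r)) (by simp) S hS
  obtain ⟨u, huS, hu⟩ := exists_functionalCalculus hm.isSymmetric
    (f := fun r => (Real.sqrt (Real.sqrt r))⁻¹) (by simp) S hS
  have he := fun i => (hm.isSymmetric.hasEigenvector_eigenvectorBasis rfl i).apply_eq_smul
  have hpos := hm.nonneg_eigenvalues rfl
  refine ⟨t, htS, u, huS, star_eq_of_eigenvectorBasis (f := fun r => Real.sqrt (Real.sqrt r)) hm.isSymmetric ht,
    star_eq_of_eigenvectorBasis (f := fun r => (Real.sqrt (Real.sqrt r))⁻¹) hm.isSymmetric hu,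
    ?_, ?_, ?_⟩
  all_goals
    refine (hm.isSymmetric.eigenvectorBasis rfl).toBasis.ext fun i => ?_
    simp only [OrthonormalBasis.coe_toBasis, Module.End.mul_apply, ht, hu, he, map_smul, smul_smul]
    congr 1
    norm_cast
  · rw [← mul_assoc, mul_assoc, Real.mul_self_sqrt (Real.sqrt_nonneg _),
      Real.mul_self_sqrt (hpos i)]
    rfl
  · ring
  · rcases (hpos i).eq_or_lt with h | h
    · simp [← h]
    · have : Real.sqrt (Real.sqrt (hm.isSymmetric.eigenvalues rfl i)) ≠ 0 := by positivity
      field_simp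
      simp

end Spectral

/-! ### Positivity of the trace -/

section Trace

variable {H : Type*} [NormedAddCommGroup H] [InnerProductSpace ℂ H] [FiniteDimensional ℂ H]

theorem inner_sliceL_trace {ι : Type*} [Fintype ι] (e : OrthonormalBasis ι ℂ H)
    (X : Module.End ℂ (H ⊗[ℂ] H)) (ξ η : H) :
    inner ℂ η (sliceL (LinearMap.trace ℂ H) X ξ) = ∑ i, inner ℂ (e i ⊗ₜ η) (X (e i ⊗ₜ ξ)) := by
  induction X using end_tensor_induction with
  | add X Y hX hY => simp [inner_add_right, hX, hY, Finset.sum_add_distrib]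
  | map x y =>
    rw [sliceL_map, LinearMap.trace_eq_sum_inner _ e]
    simp only [LinearMap.smul_apply, inner_smul_right, TensorProduct.map_tmul,
      TensorProduct.inner_tmul, Finset.sum_mul]

theorem inner_mul_star_self {E : Type*} [NormedAddCommGroup E] [InnerProductSpace ℂ E]
    [FiniteDimensional ℂ E] (Y : Module.End ℂ E) (ξ : E) :
    inner ℂ ξ ((Y * star Y) ξ) = (‖star Y ξ‖ : ℂ) ^ 2 := by
  rw [Module.End.mul_apply, ← LinearMap.adjoint_inner_left, ← LinearMap.star_eq_adjoint,
    inner_self_eq_norm_sq_to_K]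
  rfl

/-- The quadratic form at ξ is ∑ ‖Y*(eᵢ ⊗ ξ)‖² over an orthonormal basis. -/
theorem isPositive_sliceL_trace (Y : Module.End ℂ (H ⊗[ℂ] H)) :
    (sliceL (LinearMap.trace ℂ H) (Y * star Y)).IsPositive := by
  have h : ∀ ξ, 0 ≤ inner ℂ ξ (sliceL (LinearMap.trace ℂ H) (Y * star Y) ξ) := fun ξ => by
    rw [inner_sliceL_trace (stdOrthonormalBasis ℂ H)]
    refine Finset.sum_nonneg fun i _ => ?_
    rw [show inner ℂ (stdOrthonormalBasis ℂ H i ⊗ₜ[ℂ] ξ) ((Y * star Y) _) = _ from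
      inner_mul_star_self Y (stdOrthonormalBasis ℂ H i ⊗ₜ[ℂ] ξ)]
    rw [← Complex.ofReal_pow, Complex.zero_le_real]
    positivity
  rw [LinearMap.isPositive_iff_complex]
  intro ξ
  obtain ⟨h1, h2⟩ := Complex.nonneg_iff.1 (h ξ)
  rw [← inner_conj_symm]
  generalize inner ℂ ξ (sliceL (LinearMap.trace ℂ H) (Y * star Y) ξ) = z at h1 h2 ⊢
  exact ⟨Complex.ext (by simp) (by simp [← h2]), by simpa using h1⟩

theorem trace_mul_star_eq (Y : Module.End ℂ H) : LinearMap.trace ℂ H (Y * star Y) =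
    ((∑ i, ‖star Y (stdOrthonormalBasis ℂ H i)‖ ^ 2 : ℝ) : ℂ) := by
  rw [LinearMap.trace_eq_sum_inner _ (stdOrthonormalBasis ℂ H)]
  simp only [inner_mul_star_self]
  push_cast
  rfl

theorem trace_mul_star_nonneg (Y : Module.End ℂ H) : 0 ≤ LinearMap.trace ℂ H (Y * star Y) := by
  rw [trace_mul_star_eq, Complex.zero_le_real]
  positivity

theorem eq_zero_of_trace_mul_star {Y : Module.End ℂ H}
    (h : LinearMap.trace ℂ H (Y * star Y) = 0) : Y = 0 := by
  rw [trace_mul_star_eq, Complex.ofReal_eq_zero,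
    Finset.sum_eq_zero_iff_of_nonneg fun _ _ => sq_nonneg _] at h
  rw [← star_eq_zero]
  refine (stdOrthonormalBasis ℂ H).toBasis.ext fun i => ?_
  simpa using h i (Finset.mem_univ i)

end Trace

/-! ### The modular automorphism and the faithful positivity of the counit -/

variable {H : Type*} [NormedAddCommGroup H] [InnerProductSpace ℂ H] [FiniteDimensional ℂ H]

/-- The left subalgebra of a unital multiplicative partial isometry. -/
def leftSubalgebra {V : Module.End ℂ (H ⊗[ℂ] H)} (hV : IsMPI V)
    {ε εhat : Module.Dual ℂ (Module.End ℂ H)} (hu : IsUnitalBy V ε εhat) :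
    NonUnitalStarSubalgebra ℂ (Module.End ℂ H) where
  carrier := rightLeg (V * star V)
  add_mem' := Submodule.add_mem _
  zero_mem' := Submodule.zero_mem _
  smul_mem' := fun a _ hx => Submodule.smul_mem _ a hx
  mul_mem' := hu.range_right_mul_mem hV
  star_mem' := star_mem_rightLeg (star_range_proj V)

/-- `g` and `k = g⁻¹` are positive elements of `A^L`, and `g² · k²` is the modular automorphism
of the counit; `k²` is the density of the trace transported along the antipode. -/
structure IsModularPair (V : Module.End ℂ (H ⊗[ℂ] H)) (ε εhat : Module.Dual ℂ (Module.End ℂ H))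
    (c g k : Module.End ℂ H) : Prop where
  c_mem : c ∈ rightLeg (V * star V)
  c_star : star c = c
  g_eq : g = c * c
  g_mem : g ∈ rightLeg (V * star V)
  k_mem : k ∈ rightLeg (V * star V)
  g_star : star g = g
  k_star : star k = k
  g_mul_k : g * k = sliceL εhat V
  k_mul_g : k * g = sliceL εhat V
  k_sq : k * k = sliceL (LinearMap.trace ℂ H) (V * star V)

namespace IsUnitalBy

variable {V : Module.End ℂ (H ⊗[ℂ] H)} {ε εhat : Module.Dual ℂ (Module.End ℂ H)}
  {b c g k x y : Module.End ℂ H}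

theorem counit_mul_slice_trace (hV : IsMPI V) (hu : IsUnitalBy V ε εhat)
    (hx : x ∈ rightLeg (V * star V)) :
    ε (x * sliceL (LinearMap.trace ℂ H) (V * star V)) =
      LinearMap.trace ℂ H (targetMap V ε x) :=
  (apply_targetMap_range _ hV hu (range_right_mem hV hu hx)).symm

theorem trace_targetMap_mul_comm (hV : IsMPI V) (hu : IsUnitalBy V ε εhat)
    (hx : x ∈ rightLeg (V * star V)) (hy : y ∈ rightLeg (V * star V)) :
    LinearMap.trace ℂ H (targetMap V ε (x * y)) = LinearMap.trace ℂ H (targetMap V ε (y * x)) := by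
  rw [targetMap_mul hV hu hx hy, targetMap_mul hV hu hy hx, LinearMap.trace_mul_comm]

theorem counit_left_mul_slice_trace (hV : IsMPI V) (hu : IsUnitalBy V ε εhat)
    (hc : c ∈ leftLeg (V * star V)) :
    ε (c * sliceL (LinearMap.trace ℂ H) (V * star V)) = LinearMap.trace ℂ H c := by
  obtain ⟨f, rfl⟩ := hc
  exact (counit_pairing f hV hu (sliceL_mem_rightLeg _ _)).trans (apply_sliceR _ _ _).symm

/-- Invertibility of m in A^L: Tr(S(b)S(b)*) = ε(S(b)S(b)*m) = ε(bS(b)*m) = ε(S(b)*bm) = 0, so S(b)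
= 0, and S is injective on A^L. -/
theorem eq_zero_of_mul_slice_trace (hV : IsMPI V) (hu : IsUnitalBy V ε εhat)
    (hb : b ∈ rightLeg (V * star V))
    (h : b * sliceL (LinearMap.trace ℂ H) (V * star V) = 0) : b = 0 := by
  have hbA := range_right_mem hV hu hb
  have hC := star_mem_leftLeg (star_range_proj V) (targetMap_mem hV hu hbA)
  have hbC := rightLeg_mul_mem hV hbA (range_left_mem hV hu hC)
  have hm := range_right_mem hV hu (sliceL_mem_rightLeg (LinearMap.trace ℂ H) (V * star V))
  refine eq_zero_of_targetMap hV hu hb (eq_zero_of_trace_mul_star ?_)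
  rw [← targetMap_mul_left hV hu hC, ← counit_left_mul_slice_trace hV hu (targetMap_mem hV hu hbC),
    counit_targetMap_mul hV hu hbC hm, (hV.commute_right_left hb hC).eq, mul_assoc, h, mul_zero,
    map_zero]

theorem exists_isModularPair (hV : IsMPI V) (hu : IsUnitalBy V ε εhat) :
    ∃ c g k, IsModularPair V ε εhat c g k := by
  let m := sliceL (LinearMap.trace ℂ H) (V * star V)
  have hm : m ∈ leftSubalgebra hV hu := sliceL_mem_rightLeg _ _
  have hp := unit_mem_range_right hV hu
  obtain ⟨t, ht, u, hu', hts, hus, htm, hcomm, hmt⟩ := exists_fourth_root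
    (isPositive_sliceL_trace V) (leftSubalgebra hV hu).toNonUnitalSubalgebra hm
  have htu : t * u = sliceL εhat V := by
    have hm' : star (t * t * (t * t)) = t * t * (t * t) := by simp only [star_mul, hts]
    rw [htm] at hm'
    have hum : t * u * m = m := by
      have := congrArg star hmt
      rwa [star_mul, star_mul, hts, hus, hm', ← hcomm] at this
    refine sub_eq_zero.1 (eq_zero_of_mul_slice_trace hV hu (Submodule.sub_mem _
      (range_right_mul_mem hV hu ht hu') hp) ?_)
    rw [sub_mul, hu.unit_mul_rightLeg (range_right_mem hV hu hm)]
    exact sub_eq_zero.2 hum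
  have hleft : ∀ {b}, b ∈ rightLeg (V * star V) → sliceL εhat V * b = b := fun hb =>
    hu.unit_mul_rightLeg (range_right_mem hV hu hb)
  have hut := hcomm.symm.trans htu
  refine ⟨u, u * u, t * t, hu', hus, rfl, range_right_mul_mem hV hu hu' hu',
    range_right_mul_mem hV hu ht ht, ?_, ?_, ?_, ?_, htm⟩
  · rw [star_mul, hus]
  · rw [star_mul, hts]
  · rw [mul_assoc, ← mul_assoc u t, hut, hleft ht, hut]
  · rw [mul_assoc, ← mul_assoc t u, htu, hleft hu', htu]

end IsUnitalBy

namespace IsModularPair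

open IsUnitalBy

variable {V : Module.End ℂ (H ⊗[ℂ] H)} {ε εhat : Module.Dual ℂ (Module.End ℂ H)}
  {b c g k x y : Module.End ℂ H}

theorem mul_mul_cancel (hV : IsMPI V) (hu : IsUnitalBy V ε εhat)
    (hM : IsModularPair V ε εhat c g k) (hx : x ∈ rightLeg (V * star V)) :
    g * (k * x) = x ∧ k * (g * x) = x ∧ x * g * k = x ∧ x * k * g = x := by
  have hxA := range_right_mem hV hu hx
  refine ⟨?_, ?_, ?_, ?_⟩
  · rw [← mul_assoc, hM.g_mul_k, hu.unit_mul_rightLeg hxA]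
  · rw [← mul_assoc, hM.k_mul_g, hu.unit_mul_rightLeg hxA]
  · rw [mul_assoc, hM.g_mul_k, hu.rightLeg_mul_unit hxA]
  · rw [mul_assoc, hM.k_mul_g, hu.rightLeg_mul_unit hxA]

theorem mul_mem (hV : IsMPI V) (hu : IsUnitalBy V ε εhat)
    (hx : x ∈ rightLeg (V * star V)) (hy : y ∈ rightLeg (V * star V)) :
    x * y ∈ rightLeg (V * star V) := range_right_mul_mem hV hu hx hy

theorem counit_eq_trace (hV : IsMPI V) (hu : IsUnitalBy V ε εhat)
    (hM : IsModularPair V ε εhat c g k) (hx : x ∈ rightLeg (V * star V)) :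
    ε x = LinearMap.trace ℂ H (targetMap V ε (x * g * g)) := by
  have h1 := mul_mem hV hu hx hM.g_mem
  rw [← counit_mul_slice_trace hV hu (mul_mem hV hu h1 hM.g_mem), ← hM.k_sq, ← mul_assoc,
    (hM.mul_mul_cancel hV hu h1).2.2.1, (hM.mul_mul_cancel hV hu hx).2.2.1]

/-- The modular automorphism of the counit on `A^L`. -/
theorem counit_mul (hV : IsMPI V) (hu : IsUnitalBy V ε εhat)
    (hM : IsModularPair V ε εhat c g k) (hx : x ∈ rightLeg (V * star V))
    (hy : y ∈ rightLeg (V * star V)) : ε (x * y) = ε (y * (g * g * x * (k * k))) := by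
  have hgx := mul_mem hV hu (mul_mem hV hu hM.g_mem hM.g_mem) hx
  rw [← mul_assoc y, hM.k_sq, counit_mul_slice_trace hV hu (mul_mem hV hu hy hgx),
    hM.counit_eq_trace hV hu (mul_mem hV hu hx hy), mul_assoc x, mul_assoc x,
    trace_targetMap_mul_comm hV hu hx
      (mul_mem hV hu (mul_mem hV hu hy hM.g_mem) hM.g_mem)]
  simp only [mul_assoc]

theorem conj_conj_cancel (hV : IsMPI V) (hu : IsUnitalBy V ε εhat)
    (hM : IsModularPair V ε εhat c g k) (hx : x ∈ rightLeg (V * star V)) :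
    g * g * (k * k * x * (g * g)) * (k * k) = x := by
  have h1 := fun {z} hz => hM.mul_mul_cancel hV hu (x := z) hz
  have hxg := mul_mem hV hu hx hM.g_mem
  rw [mul_assoc, show k * k * x * (g * g) * (k * k) = k * (k * (x * g * g * k * k)) by
    simp only [mul_assoc], (h1 hxg).2.2.1, (h1 hx).2.2.1, mul_assoc g,
    (h1 (mul_mem hV hu hM.k_mem hx)).1, (h1 hx).1]

/-- Paired with b, the left side is the conjugate of ε(xb*), that is ε(bx*); the modular
automorphism moves b to the right. -/
theorem star_targetMap (hV : IsMPI V) (hu : IsUnitalBy V ε εhat)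
    (hM : IsModularPair V ε εhat c g k) (hx : x ∈ rightLeg (V * star V)) :
    star (targetMap V ε x) = targetMap V ε (k * k * star x * (g * g)) := by
  have hs := star_range_proj V
  have hxs := star_mem_rightLeg hs hx
  have hX : k * k * star x * (g * g) ∈ rightLeg (V * star V) :=
    mul_mem hV hu (mul_mem hV hu (mul_mem hV hu hM.k_mem hM.k_mem) hxs)
      (mul_mem hV hu hM.g_mem hM.g_mem)
  have hxA := range_right_mem hV hu hx
  have hXA := range_right_mem hV hu hX
  have hxC := targetMap_mem hV hu hxA
  rw [← sub_eq_zero]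
  refine left_eq_zero hV hu (Submodule.sub_mem _ (star_mem_leftLeg hs hxC)
    (targetMap_mem hV hu hXA)) fun b hb => ?_
  have hbs := star_mem_rightLeg hs hb
  rw [sub_mul, map_sub, sub_eq_zero, counit_targetMap_mul hV hu hXA (range_right_mem hV hu hb),
    hM.counit_mul hV hu hX hb, hM.conj_conj_cancel hV hu hxs]
  conv_lhs => rw [← star_star b]
  rw [counit_star_mul_star hV hu hxC hbs, counit_targetMap_mul hV hu hxA (range_right_mem hV hu hbs),
    ← counit_star hV hu (mul_mem hV hu hx hbs), star_mul, star_star]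

/-- The twisted antipode is a *-map. -/
theorem star_targetMap_conj (hV : IsMPI V) (hu : IsUnitalBy V ε εhat)
    (hM : IsModularPair V ε εhat c g k) (hx : x ∈ rightLeg (V * star V)) :
    targetMap V ε (k * star x * g) = star (targetMap V ε (k * x * g)) := by
  have hxs := star_mem_rightLeg (star_range_proj V) hx
  have hkx := mul_mem hV hu hM.k_mem hx
  rw [hM.star_targetMap hV hu (mul_mem hV hu hkx hM.g_mem), star_mul, star_mul, hM.g_star,
    hM.k_star, show k * k * (g * (star x * k)) * (g * g) = k * (k * (g * (star x * k * g * g))) by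
      simp only [mul_assoc],
    (hM.mul_mul_cancel hV hu hxs).2.2.2,
    (hM.mul_mul_cancel hV hu (mul_mem hV hu hxs hM.g_mem)).2.1, mul_assoc]

theorem targetMap_conj_mul (hV : IsMPI V) (hu : IsUnitalBy V ε εhat)
    (hM : IsModularPair V ε εhat c g k) (hx : x ∈ rightLeg (V * star V))
    (hy : y ∈ rightLeg (V * star V)) :
    targetMap V ε (k * (x * y) * g) = targetMap V ε (k * y * g) * targetMap V ε (k * x * g) := by
  have hkx := mul_mem hV hu hM.k_mem hx
  have hky := mul_mem hV hu hM.k_mem hy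
  rw [← targetMap_mul hV hu (mul_mem hV hu hkx hM.g_mem) (mul_mem hV hu hky hM.g_mem),
    show k * x * g * (k * y * g) = k * x * (g * (k * (y * g))) by simp only [mul_assoc],
    (hM.mul_mul_cancel hV hu (mul_mem hV hu hy hM.g_mem)).1]
  simp only [mul_assoc]

theorem eq_zero_of_conj (hV : IsMPI V) (hu : IsUnitalBy V ε εhat)
    (hM : IsModularPair V ε εhat c g k) (hx : x ∈ rightLeg (V * star V))
    (h : k * x * g = 0) : x = 0 := by
  have hkx := mul_mem hV hu hM.k_mem hx
  have h1 := (hM.mul_mul_cancel hV hu hkx).2.2.1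
  rw [h, zero_mul] at h1
  have h2 := (hM.mul_mul_cancel hV hu hx).1
  rw [← h1, mul_zero] at h2
  exact h2.symm

/-- With Y = S_o(xg) one has Y* = S_o(gx*) = S(x*g), so YY* = S(x*xg²), whose trace is ε(x*x). -/
theorem counit_star_mul_self (hV : IsMPI V) (hu : IsUnitalBy V ε εhat)
    (hM : IsModularPair V ε εhat c g k) (hx : x ∈ rightLeg (V * star V)) :
    ε (star x * x) = LinearMap.trace ℂ H
      (targetMap V ε (k * (x * g) * g) * star (targetMap V ε (k * (x * g) * g))) := by
  have hxs := star_mem_rightLeg (star_range_proj V) hx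
  have hxg := mul_mem hV hu hx hM.g_mem
  have hgs := mul_mem hV hu hM.g_mem hxs
  have hZ := mul_mem hV hu (mul_mem hV hu hM.k_mem hxg) hM.g_mem
  rw [← hM.star_targetMap_conj hV hu hxg, ← targetMap_mul hV hu ?_ hZ,
    hM.counit_eq_trace hV hu (mul_mem hV hu hxs hx), star_mul, hM.g_star, ← mul_assoc k,
    (show k * g * star x = star x by
      rw [mul_assoc]; exact (hM.mul_mul_cancel hV hu hxs).2.1),
    show star x * g * (k * (x * g) * g) = star x * (g * (k * (x * g * g))) by
      simp only [mul_assoc], (hM.mul_mul_cancel hV hu (mul_mem hV hu hxg hM.g_mem)).1]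
  · simp only [mul_assoc]
  · rw [star_mul, hM.g_star]
    exact mul_mem hV hu (mul_mem hV hu hM.k_mem hgs) hM.g_mem

theorem counit_nonneg (hV : IsMPI V) (hu : IsUnitalBy V ε εhat)
    (hM : IsModularPair V ε εhat c g k) (hx : x ∈ rightLeg (V * star V)) :
    0 ≤ ε (star x * x) := by
  rw [hM.counit_star_mul_self hV hu hx]
  exact trace_mul_star_nonneg _

theorem counit_faithful (hV : IsMPI V) (hu : IsUnitalBy V ε εhat)
    (hM : IsModularPair V ε εhat c g k) (hx : x ∈ rightLeg (V * star V))
    (h : ε (star x * x) = 0) : x = 0 := by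
  rw [hM.counit_star_mul_self hV hu hx] at h
  have hxg := mul_mem hV hu hx hM.g_mem
  have h1 := eq_zero_of_targetMap hV hu
    (mul_mem hV hu (mul_mem hV hu hM.k_mem hxg) hM.g_mem) (eq_zero_of_trace_mul_star h)
  have h2 := hM.eq_zero_of_conj hV hu hxg h1
  have h3 := (hM.mul_mul_cancel hV hu hx).2.2.1
  rw [h2, zero_mul] at h3
  exact h3.symm

end IsModularPair

variable {H : Type*} [NormedAddCommGroup H] [InnerProductSpace ℂ H] [FiniteDimensional ℂ H]

/-! ### Restricting partial isometries to unitaries -/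

section Unitary

theorem star_flip : star (flip H) = flip H := by
  symm
  rw [LinearMap.star_eq_adjoint]
  refine (LinearMap.eq_adjoint_iff _ _).2 fun x y => ?_
  change inner ℂ (TensorProduct.comm ℂ H H x) y = inner ℂ x (TensorProduct.comm ℂ H H y)
  rw [← TensorProduct.inner_comm_comm (𝕜 := ℂ) (TensorProduct.comm ℂ H H x) y]
  congr 1
  exact (TensorProduct.comm ℂ H H).symm_apply_apply x

theorem star_leg21 (X : Module.End ℂ (H ⊗[ℂ] H)) : star (leg21 X) = leg21 (star X) := by
  rw [leg21, star_leg12, star_mul_tensor, star_mul_tensor, star_flip, leg21, mul_assoc]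

theorem norm_apply_of_star_mul {E : Type*} [NormedAddCommGroup E] [InnerProductSpace ℂ E]
    [FiniteDimensional ℂ E] {f : Module.End ℂ E} {ξ : E} (h : star f (f ξ) = ξ) :
    ‖f ξ‖ = ‖ξ‖ := by
  have h1 : inner ℂ (f ξ) (f ξ) = inner ℂ ξ ξ := by
    rw [← LinearMap.adjoint_inner_right, ← LinearMap.star_eq_adjoint, h]
  rw [inner_self_eq_norm_sq_to_K, inner_self_eq_norm_sq_to_K] at h1
  have h2 : ‖f ξ‖ ^ 2 = ‖ξ‖ ^ 2 := by exact_mod_cast h1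
  exact (sq_eq_sq₀ (norm_nonneg _) (norm_nonneg _)).1 h2

theorem RestrictsToUnitary.of_star {f P Q : Module.End ℂ (H ⊗[ℂ] (H ⊗[ℂ] H))}
    (h1 : f * P = Q * f) (h2 : star f * Q = P * star f) (h3 : star f * f * P = P)
    (h4 : f * star f * Q = Q) : RestrictsToUnitary f P Q := by
  have h3' : ∀ η, star f (f (P η)) = P η := fun η => LinearMap.congr_fun h3 η
  refine ⟨⟨?_, ?_, ?_⟩, ?_⟩
  · rintro _ ⟨η, rfl⟩
    exact ⟨f η, (LinearMap.congr_fun h1 η).symm⟩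
  · rintro _ ⟨η, rfl⟩ _ ⟨η', rfl⟩ h
    rw [← h3' η, ← h3' η']
    exact congrArg _ h
  · rintro _ ⟨η, rfl⟩
    refine ⟨P (star f η), ⟨_, rfl⟩, ?_⟩
    have e1 := LinearMap.congr_fun h2 η
    have e2 := LinearMap.congr_fun h4 η
    simp only [Module.End.mul_apply] at e1 e2
    rw [← e1, e2]
  · rintro _ ⟨η, rfl⟩
    exact norm_apply_of_star_mul (E := H ⊗[ℂ] (H ⊗[ℂ] H)) (h3' η)

theorem RestrictsToUnitary.of_unitary {f P Q : Module.End ℂ (H ⊗[ℂ] (H ⊗[ℂ] H))}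
    (h1 : f * P = Q * f) (h3 : star f * f = 1) (h4 : f * star f = 1) :
    RestrictsToUnitary f P Q := by
  refine .of_star h1 ?_ (by rw [h3, one_mul]) (by rw [h4, one_mul])
  have := congrArg (fun T => star f * T * star f) h1
  simp only [mul_assoc] at this
  rw [h4, mul_one, ← mul_assoc (star f) f, h3, one_mul] at this
  exact this.symm

/-- The relation and its adjoint make X commute with f*f and Y with ff*, so f carries the part of
its initial space cut out by X onto the part of its final space cut out by Y. -/
theorem RestrictsToUnitary.of_intertwines {f X Y : Module.End ℂ (H ⊗[ℂ] (H ⊗[ℂ] H))}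
    (hf : f * star f * f = f) (hX : star X = X) (hY : star Y = Y) (h : f * X = Y * f) :
    RestrictsToUnitary f (X * (star f * f)) (Y * (f * star f)) := by
  have hf' : star f * (f * star f) = star f := by
    simpa only [star_mul, star_star] using congrArg star hf
  have h' : X * star f = star f * Y := by
    simpa only [star_mul, hX, hY] using congrArg star h
  have hc : star f * f * X = X * (star f * f) := by
    rw [mul_assoc, h, ← mul_assoc, ← h', mul_assoc]
  have hd : f * star f * Y = Y * (f * star f) := by
    rw [mul_assoc, ← h', ← mul_assoc, h, mul_assoc]
  refine .of_star ?_ ?_ ?_ ?_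
  · rw [← hc, ← mul_assoc, ← mul_assoc, hf, mul_assoc, mul_assoc, ← mul_assoc f, hf, h]
  · rw [← hd, ← mul_assoc, hf', ← h', mul_assoc, mul_assoc, hf']
  · rw [← mul_assoc, hc, mul_assoc, mul_assoc (star f), ← mul_assoc f, hf]
  · rw [← mul_assoc, hd, mul_assoc, mul_assoc f, hf']

theorem RestrictsToUnitary.of_intertwines' {f X Y : Module.End ℂ (H ⊗[ℂ] (H ⊗[ℂ] H))}
    (hf : f * star f * f = f) (hX : star X = X) (hY : star Y = Y) (h : f * X = Y * f) :
    RestrictsToUnitary f (star f * f * X) (f * star f * Y) := by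
  have h' : X * star f = star f * Y := by
    simpa only [star_mul, hX, hY] using congrArg star h
  have hc : star f * f * X = X * (star f * f) := by
    rw [mul_assoc, h, ← mul_assoc, ← h', mul_assoc]
  have hd : f * star f * Y = Y * (f * star f) := by
    rw [mul_assoc, ← h', ← mul_assoc, h, mul_assoc]
  rw [hc, hd]
  exact .of_intertwines hf hX hY h

end Unitary

/-! ### The restricted unitary and the pentagon diagram -/

section Extend

variable {V : Module.End ℂ (H ⊗[ℂ] H)}

/-- The restriction of a partial isometry to its initial and final supports. -/
def IsMPI.restrict (hV : IsMPI V) :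
    LinearMap.range (star V * V) ≃ₗᵢ[ℂ] LinearMap.range (V * star V) where
  toFun ξ := ⟨V ξ, by
    obtain ⟨_, η, rfl⟩ := ξ
    refine ⟨V η, ?_⟩
    change (V * star V * V) η = (V * (star V * V)) η
    rw [mul_assoc]⟩
  invFun η := ⟨star V η, by
    obtain ⟨_, ξ, rfl⟩ := η
    refine ⟨star V ξ, ?_⟩
    change (star V * V * star V) ξ = (star V * (V * star V)) ξ
    rw [mul_assoc]⟩
  map_add' ξ η := by ext; simp
  map_smul' a ξ := by ext; simp
  left_inv := by
    rintro ⟨_, ξ, rfl⟩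
    exact Subtype.ext (LinearMap.congr_fun hV.domain_proj_idem ξ)
  right_inv := by
    rintro ⟨_, ξ, rfl⟩
    exact Subtype.ext (LinearMap.congr_fun hV.range_proj_idem ξ)
  norm_map' := by
    rintro ⟨_, ξ, rfl⟩
    exact norm_apply_of_star_mul (E := H ⊗[ℂ] H) (LinearMap.congr_fun hV.domain_proj_idem ξ)

theorem IsMPI.extend_restrict (hV : IsMPI V) : extend hV.restrict = V := by
  refine LinearMap.ext fun ξ => ?_
  change (V * (star V * V)) ξ = V ξ
  rw [← mul_assoc, hV.partial_isometry]

theorem IsMPI.intertwines (hV : IsMPI V) {B : Type*} {S T : B → Module.End ℂ (H ⊗[ℂ] H)}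
    (hS : ∀ x, Commute (S x) (star V * V)) (hT : ∀ x, V * S x = T x * V) :
    Intertwines hV.restrict S T := by
  rintro x ⟨_, η, rfl⟩
  exact ⟨⟨S x η, (LinearMap.congr_fun (hS x).eq η).symm⟩,
    LinearMap.congr_fun (hT x) ((star V * V) η)⟩

theorem IsUnitalBy.pentagonDiagram (hV : IsMPI V) {ε εhat : Module.Dual ℂ (Module.End ℂ H)}
    (hu : IsUnitalBy V ε εhat) : PentagonDiagram hV.restrict := by
  have hs12 : star (leg12 (flip H)) = leg12 (flip H) := by rw [star_leg12, star_flip]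
  have hs23 : star (leg23 (flip H)) = leg23 (flip H) := by rw [star_leg23, star_flip]
  have hE := star_range_proj V
  have hF := star_domain_proj V
  have p12 : leg12 V * star (leg12 V) * leg12 V = leg12 V := by
    rw [star_leg12, ← leg12_mul, ← leg12_mul, hV.partial_isometry]
  have p23 : leg23 V * star (leg23 V) * leg23 V = leg23 V := by
    rw [star_leg23, ← leg23_mul, ← leg23_mul, hV.partial_isometry]
  have e12 : leg12 (V * star V) = leg12 V * star (leg12 V) := by rw [star_leg12, leg12_mul]
  have f12 : leg12 (star V * V) = star (leg12 V) * leg12 V := by rw [star_leg12, leg12_mul]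
  have e23 : leg23 (V * star V) = leg23 V * star (leg23 V) := by rw [star_leg23, leg23_mul]
  have f23 : leg23 (star V * V) = star (leg23 V) * leg23 V := by rw [star_leg23, leg23_mul]
  have sE12 : star (leg12 (V * star V)) = leg12 (V * star V) := by rw [star_leg12, hE]
  have sF12 : star (leg12 (star V * V)) = leg12 (star V * V) := by rw [star_leg12, hF]
  have sE23 : star (leg23 (V * star V)) = leg23 (V * star V) := by rw [star_leg23, hE]
  have sF23 : star (leg23 (star V * V)) = leg23 (star V * V) := by rw [star_leg23, hF]
  have sE13 : star (leg13 (V * star V)) = leg13 (V * star V) := by rw [star_leg13, hE]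
  have sF13 : star (leg13 (star V * V)) = leg13 (star V * V) := by rw [star_leg13, hF]
  have sF21 : star (leg21 (star V * V)) = leg21 (star V * V) := by rw [star_leg21, hF]
  have c1 : leg12 V * leg23 (star V * V) = leg23 (star V * V) * leg12 V := by
    rw [leg23_mul, ← mul_assoc, hV.domain_commute]
  have c2 : leg23 V * leg12 (V * star V) = leg12 (V * star V) * leg23 V := by
    rw [leg12_mul, hV.range_commute, mul_assoc]
  -- The first slice is V(c ⊗ 1) = (1 ⊗ c)V, with c in the right leg of F, which is C. `c4` is the
  -- third-leg analogue, with c in the left leg of E.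
  have c3 : leg23 V * leg12 (star V * V) = leg13 (star V * V) * leg23 V := by
    refine eq_of_sliceL fun f => ?_
    change slice1 f _ = slice1 f _
    rw [slice1_leg23_mul, slice1_mul_leg23, slice1_leg12, slice1_leg13]
    exact mul_rTensor_left hV hu (rightLeg_domain hV hu ▸ sliceL_mem_rightLeg f _)
  have c4 : leg12 V * leg13 (V * star V) = leg23 (V * star V) * leg12 V := by
    refine eq_of_slice3 fun f => ?_
    rw [slice3_leg12_mul, slice3_mul_leg12, slice3_leg13, slice3_leg23]
    exact mul_rTensor_left hV hu (sliceR_mem_leftLeg f _)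
  -- This is V₁₃E₂₃ = F₁₂V₁₃ conjugated by Σ₁₂.
  have c5 : leg23 V * leg13 (V * star V) = leg21 (star V * V) * leg23 V := by
    have h : leg12 (flip H) * (leg23 V * leg13 (V * star V)) =
        leg12 (flip H) * (leg21 (star V * V) * leg23 V) := by
      rw [← mul_assoc, leg12_flip_mul_leg23, mul_assoc, leg12_flip_mul_leg13, ← mul_assoc,
        hV.leg13_mul_range, mul_assoc, ← leg12_flip_mul_leg23, ← mul_assoc, ← mul_assoc,
        leg12_flip_mul_leg21]
    have := congrArg (leg12 (flip H) * ·) h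
    simpa only [← mul_assoc, leg12_flip_mul_self, one_mul] using this
  have c6 : leg13 (V * star V) * leg23 (star V * V) =
      leg23 (star V * V) * leg13 (V * star V) := by
    have h : leg13 (V * star V) * star (leg23 V) = star (leg23 V) * leg21 (star V * V) := by
      simpa only [star_mul, sE13, sF21] using congrArg star c5
    rw [f23, ← mul_assoc, h, mul_assoc, ← c5, mul_assoc]
  have hext := hV.extend_restrict
  constructor
  · rw [hext]
    nth_rewrite 1 [f12]
    rw [e12]
    exact .of_intertwines' p12 sF23 sF23 c1
  · rw [hext, e23, f23]
    exact .of_intertwines p23 sE12 sE12 c2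
  · rw [hext, e23, f23]
    exact .of_intertwines p23 sF12 sF13 c3
  · refine .of_unitary ?_ (by rw [hs23, leg23_flip_mul_self]) (by rw [hs23, leg23_flip_mul_self])
    rw [← mul_assoc, leg23_flip_mul_leg13, mul_assoc, leg23_flip_mul_leg23, mul_assoc]
  · refine .of_unitary ?_ ?_ ?_
    · rw [← mul_assoc, flip12_3_mul_leg12, mul_assoc, flip12_3_mul_leg32, ← mul_assoc]
      rw [c6]
    · rw [flip12_3_eq, star_mul, hs12, hs23, mul_assoc, ← mul_assoc (leg12 (flip H)),
        leg12_flip_mul_self, one_mul, leg23_flip_mul_self]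
    · rw [flip12_3_eq, star_mul, hs12, hs23, mul_assoc, ← mul_assoc (leg23 (flip H)),
        leg23_flip_mul_self, one_mul, leg12_flip_mul_self]
  · rw [hext, e23, f23]
    exact .of_intertwines p23 sE13 sF21 c5
  · refine .of_unitary ?_ (by rw [hs12, leg12_flip_mul_self]) (by rw [hs12, leg12_flip_mul_self])
    rw [← mul_assoc, leg12_flip_mul_leg21, mul_assoc, leg12_flip_mul_leg23, mul_assoc]
  · rw [hext, e12, f12]
    exact .of_intertwines' p12 sE13 sE23 c4
  · intro ξ _
    rw [hext]
    have h : leg23 V * leg12 V = leg12 V * (leg12 (flip H) * (leg23 V *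
        (flip12_3 H * leg23 (flip H) * leg23 V))) := by
      rw [flip12_3_mul_leg23_flip, hV.pentagon, leg13]
      simp only [mul_assoc]
    exact LinearMap.congr_fun h ξ

end Extend

open IsUnitalBy

variable {H : Type*} [NormedAddCommGroup H] [InnerProductSpace ℂ H] [FiniteDimensional ℂ H]
  {V : Module.End ℂ (H ⊗[ℂ] H)} {ε εhat : Module.Dual ℂ (Module.End ℂ H)}

/-! ### Dual bases of A^L, the actions, and the relative tensor products -/

section LeftSubalgebra

variable (hV : IsMPI V) (hu : IsUnitalBy V ε εhat)

instance : FiniteDimensional ℂ (leftSubalgebra hV hu) :=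
  inferInstanceAs (FiniteDimensional ℂ (rightLeg (V * star V)))

/-- The inclusion of `A^L`. -/
def inclusion : leftSubalgebra hV hu →ₗ[ℂ] Module.End ℂ H :=
  (rightLeg (V * star V)).subtype

@[simp] theorem inclusion_apply (x : leftSubalgebra hV hu) : inclusion hV hu x = x := rfl

/-- The restriction of the counit to `A^L`. -/
def counit : leftSubalgebra hV hu →ₗ[ℂ] ℂ := ε ∘ₗ inclusion hV hu

@[simp] theorem counit_apply (x : leftSubalgebra hV hu) : counit hV hu x = ε x := rfl

/-- The unit of `A^L`. -/
def unitElem : leftSubalgebra hV hu := ⟨sliceL εhat V, hu.unit_mem_range_right hV⟩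

theorem isUnitElem_unitElem : IsUnitElem (unitElem hV hu) := fun x =>
  ⟨Subtype.ext (hu.unit_mul_rightLeg (hu.range_right_mem hV x.2)),
    Subtype.ext (hu.rightLeg_mul_unit (hu.range_right_mem hV x.2))⟩

/-- The left action `α₁₂`. -/
def sourceAction : leftSubalgebra hV hu →ₗ[ℂ] Module.End ℂ H :=
  sourceMap V ε ∘ₗ inclusion hV hu

theorem isLeftAction_sourceAction : IsLeftAction (sourceAction hV hu) where
  map_mul x y := sourceMap_mul hV hu x.2 y
  map_star x := sourceMap_star hV hu x.2

theorem isLeftAction_inclusion : IsLeftAction (inclusion hV hu) where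
  map_mul _ _ := rfl
  map_star _ := rfl

variable {hV hu}

/-- Expansion of `V V*` in a basis of `A^L`. -/
theorem range_proj_eq_sum {n : ℕ} {a : Module.Basis (Fin n) ℂ (leftSubalgebra hV hu)}
    {b : Fin n → leftSubalgebra hV hu} (h : IsDualFamily (counit hV hu) a b) :
    V * star V = ∑ i, TensorProduct.map (targetMap V ε (b i)) (a i : Module.End ℂ H) := by
  refine eq_of_sliceL fun f => ?_
  have hf := sliceL_mem_rightLeg f (V * star V)
  let y : leftSubalgebra hV hu := ⟨_, hf⟩
  -- The i-th coordinate of y is ε(bᵢy) by duality, and y is the slice of E by f.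
  have hy : ∀ i, a.repr y i = f (targetMap V ε (b i)) := fun i => by
    rw [apply_targetMap_range f hV hu (range_right_mem hV hu (b i).2)]
    change _ = counit hV hu (b i * y)
    conv_rhs => rw [← a.sum_repr y, Finset.mul_sum, map_sum]
    simp [mul_smul_comm, h i]
  have e := congrArg (inclusion hV hu) (a.sum_repr y)
  simp only [map_sum, map_smul, hy] at e
  simp only [map_sum, sliceL_map]
  exact e.symm

/-- Expansion of `V* V` in a basis of `A^L`. -/
theorem domain_proj_eq_sum {n : ℕ} {a : Module.Basis (Fin n) ℂ (leftSubalgebra hV hu)}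
    {b : Fin n → leftSubalgebra hV hu} (h : IsDualFamily (counit hV hu) a b) :
    star V * V = ∑ i, TensorProduct.map (sourceMap V ε (a i)) (targetMap V ε (b i)) := by
  refine eq_of_sliceR fun f => ?_
  rw [← sourceMap_slice f hV hu, range_proj_eq_sum h]
  simp only [map_sum, sliceL_map, sliceR_map, map_smul]

theorem sum_mul_eq_unitElem {n : ℕ} {a : Module.Basis (Fin n) ℂ (leftSubalgebra hV hu)}
    {b : Fin n → leftSubalgebra hV hu} (h : IsDualFamily (counit hV hu) a b) :
    ∑ i, a i * b i = unitElem hV hu := by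
  apply Subtype.ext
  have e := sum_mul_eq_unit hV hu (fun i => (a i : Module.End ℂ H))
    (fun i => (b i : Module.End ℂ H)) (fun i => (a i).2) (fun i => (b i).2) (range_proj_eq_sum h)
  change _ = sliceL εhat V
  rw [← e]
  change inclusion hV hu _ = _
  simp only [map_sum]
  rfl

variable (hV hu) in
theorem exists_dual_bases : ∃ (n : ℕ) (a b : Module.Basis (Fin n) ℂ (leftSubalgebra hV hu)),
    IsDualFamily (counit hV hu) a b := by
  let B : LinearMap.BilinForm ℂ (leftSubalgebra hV hu) :=
    (LinearMap.mul ℂ (leftSubalgebra hV hu)).compr₂ (counit hV hu)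
  have hB : B.Nondegenerate := by
    refine ⟨fun x hx => ?_, fun x hx => ?_⟩
    · exact Subtype.ext (right_eq_zero hV hu x.2 fun y hy => hx ⟨y, hy⟩)
    · exact Subtype.ext (right_eq_zero' hV hu x.2 fun y hy => hx ⟨y, hy⟩)
  let a := Module.finBasis ℂ (leftSubalgebra hV hu)
  refine ⟨_, a, B.dualBasis hB a, fun i j => ?_⟩
  have := B.apply_dualBasis_left hB a i j
  simp only [eq_comm (a := j)] at this
  exact this

end LeftSubalgebra

namespace IsModularPair

variable {hV : IsMPI V} {hu : IsUnitalBy V ε εhat} {c g k : Module.End ℂ H}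

variable (hV hu) in
/-- The square root of the modular automorphism. -/
def modularSqrt (hM : IsModularPair V ε εhat c g k) :
    leftSubalgebra hV hu ≃ₗ[ℂ] leftSubalgebra hV hu where
  toFun x := ⟨g, hM.g_mem⟩ * x * ⟨k, hM.k_mem⟩
  invFun x := ⟨k, hM.k_mem⟩ * x * ⟨g, hM.g_mem⟩
  map_add' x y := by rw [mul_add, add_mul]
  map_smul' a x := by rw [mul_smul_comm, smul_mul_assoc]; rfl
  left_inv x := by
    apply Subtype.ext
    change k * (g * x * k) * g = x
    rw [← mul_assoc, (hM.mul_mul_cancel hV hu x.2).2.1,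
      (hM.mul_mul_cancel hV hu x.2).2.2.2]
  right_inv x := by
    apply Subtype.ext
    change g * (k * x * g) * k = x
    rw [← mul_assoc, (hM.mul_mul_cancel hV hu x.2).1,
      (hM.mul_mul_cancel hV hu x.2).2.2.1]

theorem isModularSqrt (hM : IsModularPair V ε εhat c g k) :
    IsModularSqrt (counit hV hu) (hM.modularSqrt hV hu) := by
  refine ⟨unitElem hV hu, ⟨g, hM.g_mem⟩, ⟨k, hM.k_mem⟩, isUnitElem_unitElem hV hu,
    ⟨⟨c, hM.c_mem⟩, Subtype.ext ?_⟩, Subtype.ext hM.g_mul_k, Subtype.ext hM.k_mul_g,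
    fun x y => hM.counit_mul hV hu x.2 y.2, fun x => rfl⟩
  change g = star c * c
  rw [hM.c_star, hM.g_eq]

-- In the opposite algebra conjugation by g reads x ↦ kxg, so the square root of the modular
-- automorphism is inverted.
open MulOpposite in
theorem isModularSqrt_op (hM : IsModularPair V ε εhat c g k) :
    IsModularSqrt (opFunctional (counit hV hu)) ((opLinearEquiv ℂ).symm ≪≫ₗ
      (hM.modularSqrt hV hu).symm ≪≫ₗ opLinearEquiv ℂ) := by
  refine ⟨op (unitElem hV hu), op ⟨g, hM.g_mem⟩, op ⟨k, hM.k_mem⟩, fun x => ?_,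
    ⟨op ⟨c, hM.c_mem⟩, ?_⟩, ?_, ?_, fun x y => ?_, fun x => ?_⟩
  · exact ⟨unop_injective ((isUnitElem_unitElem hV hu) (unop x)).2,
      unop_injective ((isUnitElem_unitElem hV hu) (unop x)).1⟩
  · refine unop_injective (Subtype.ext ?_)
    change g = c * star c
    rw [hM.c_star, hM.g_eq]
  · exact unop_injective (Subtype.ext hM.k_mul_g)
  · exact unop_injective (Subtype.ext hM.g_mul_k)
  · have hx := (unop x).2
    have hX : k * k * (unop x : leftSubalgebra hV hu) * (g * g) ∈ rightLeg (V * star V) :=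
      mul_mem hV hu (mul_mem hV hu (mul_mem hV hu hM.k_mem hM.k_mem) hx)
        (mul_mem hV hu hM.g_mem hM.g_mem)
    change ε ((unop y : leftSubalgebra hV hu) * (unop x : leftSubalgebra hV hu)) =
      ε (k * k * ((unop x : leftSubalgebra hV hu) * (g * g)) * (unop y : leftSubalgebra hV hu))
    rw [← mul_assoc (k * k), hM.counit_mul hV hu hX (unop y).2, hM.conj_conj_cancel hV hu hx]
  · refine unop_injective (Subtype.ext ?_)
    change k * (unop x : leftSubalgebra hV hu) * g = k * ((unop x : leftSubalgebra hV hu) * g)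
    rw [mul_assoc]

theorem counit_mul_modularSqrt (hM : IsModularPair V ε εhat c g k)
    (x y : leftSubalgebra hV hu) :
    counit hV hu (y * hM.modularSqrt hV hu (hM.modularSqrt hV hu x)) = counit hV hu (x * y) := by
  change ε (y * (g * (g * x * k) * k)) = ε (x * y)
  rw [hM.counit_mul hV hu x.2 y.2]
  simp only [mul_assoc]

theorem counit_modularSqrt (hM : IsModularPair V ε εhat c g k) (x : leftSubalgebra hV hu) :
    counit hV hu (hM.modularSqrt hV hu x) = counit hV hu x := by
  have hgg := mul_mem hV hu hM.g_mem hM.g_mem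
  change ε (g * x * k) = ε x
  rw [mul_assoc, hM.counit_mul hV hu hM.g_mem (mul_mem hV hu x.2 hM.k_mem), ← mul_assoc _ k,
    (hM.mul_mul_cancel hV hu hgg).2.2.1, (hM.mul_mul_cancel hV hu hM.g_mem).2.2.1,
    (hM.mul_mul_cancel hV hu x.2).2.2.2]

theorem modularSqrt_mul (hM : IsModularPair V ε εhat c g k) (x y : leftSubalgebra hV hu) :
    hM.modularSqrt hV hu (x * y) = hM.modularSqrt hV hu x * hM.modularSqrt hV hu y := by
  apply Subtype.ext
  change g * (x * y) * k = g * x * k * (g * y * k)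
  rw [show g * x * k * (g * y * k) = g * x * (k * (g * (y * k))) by simp only [mul_assoc],
    (hM.mul_mul_cancel hV hu (mul_mem hV hu y.2 hM.k_mem)).2.1]
  simp only [mul_assoc]

variable (hV hu) in
/-- The right action `α₀₂`. -/
def rightAction (hM : IsModularPair V ε εhat c g k) :
    leftSubalgebra hV hu →ₗ[ℂ] Module.End ℂ H :=
  targetMap V ε ∘ₗ inclusion hV hu ∘ₗ (hM.modularSqrt hV hu).symm.toLinearMap

theorem rightAction_mem (hM : IsModularPair V ε εhat c g k) (x : leftSubalgebra hV hu) :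
    hM.rightAction hV hu x ∈ leftLeg (V * star V) :=
  targetMap_mem hV hu (range_right_mem hV hu ((hM.modularSqrt hV hu).symm x).2)

theorem isRightAction (hM : IsModularPair V ε εhat c g k) :
    IsRightAction (hM.rightAction hV hu) where
  map_mul x y := hM.targetMap_conj_mul hV hu x.2 y.2
  map_star x := hM.star_targetMap_conj hV hu x.2

theorem isRelTensorProj_range (hM : IsModularPair V ε εhat c g k) :
    IsRelTensorProj (counit hV hu) (hM.rightAction hV hu) (inclusion hV hu) (V * star V) := by
  obtain ⟨n, a, b, hab⟩ := exists_dual_bases hV hu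
  set θ := hM.modularSqrt hV hu with hθ
  -- For this basis and its dual the relative element is ∑ θ(bᵢ) ⊗ aᵢ, the index being 1, and
  -- S_o(θ(bᵢ)) = S(bᵢ) recovers E.
  have hd : IsDualFamily (counit hV hu) (b.map θ) (fun i => θ.symm (a i)) := by
    intro i j
    rw [Module.Basis.map_apply, ← hM.counit_mul_modularSqrt, ← hθ, θ.apply_symm_apply, hθ,
      ← hM.modularSqrt_mul, hM.counit_modularSqrt, hab j i]
    simp only [eq_comm]
  refine ⟨hM.isRightAction, isLeftAction_inclusion hV hu, _, ⟨n, b.map θ, fun i => θ.symm (a i),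
    unitElem hV hu, unitElem hV hu, θ, hd, isUnitElem_unitElem hV hu, ?_, ?_, hM.isModularSqrt, rfl⟩, ?_⟩
  · rw [sum_mul_eq_unitElem hd]; exact (isUnitElem_unitElem hV hu _).1
  · rw [sum_mul_eq_unitElem hd]; exact (isUnitElem_unitElem hV hu _).1
  · rw [range_proj_eq_sum hab, pairOp, map_sum, map_sum]
    refine Finset.sum_congr rfl fun i _ => ?_
    change _ = TensorProduct.map (hM.rightAction hV hu (unitElem hV hu * θ (b i)))
      (inclusion hV hu (θ (θ.symm (a i))))
    rw [(isUnitElem_unitElem hV hu _).1, θ.apply_symm_apply]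
    change _ = TensorProduct.map (targetMap V ε (θ.symm (θ (b i)) : leftSubalgebra hV hu)) _
    rw [θ.symm_apply_apply]
    rfl

open MulOpposite in
theorem isRelTensorProj_domain (hM : IsModularPair V ε εhat c g k) :
    IsRelTensorProj (opFunctional (counit hV hu)) (opAction (sourceAction hV hu))
      (opAction (hM.rightAction hV hu)) (star V * V) := by
  obtain ⟨n, a, b, hab⟩ := exists_dual_bases hV hu
  set θ := hM.modularSqrt hV hu with hθ
  -- In the opposite algebra the basis aᵢ has dual θ²(bᵢ). Its index is ∑ θ²(bᵢ)aᵢ in the original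
  -- product, so it is 1 by applying the index formula to this pair. The opposite root θ⁻¹ then
  -- leaves θ(bᵢ), and S_o(θ(bᵢ)) = S(bᵢ) recovers F.
  have hd : IsDualFamily (counit hV hu) (b.map (θ ≪≫ₗ θ)) a := by
    intro i j
    rw [Module.Basis.map_apply, LinearEquiv.trans_apply, hM.counit_mul_modularSqrt, hab j i]
    simp only [eq_comm]
  have hu1 : IsUnitElem (op (unitElem hV hu)) := fun x =>
    ⟨unop_injective ((isUnitElem_unitElem hV hu) (unop x)).2,
      unop_injective ((isUnitElem_unitElem hV hu) (unop x)).1⟩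
  have hsum : ∑ i, (a.map (opLinearEquiv ℂ)) i * op (θ (θ (b i))) = op (unitElem hV hu) := by
    rw [← sum_mul_eq_unitElem hd]
    exact (map_sum (opLinearEquiv ℂ : leftSubalgebra hV hu ≃ₗ[ℂ] _)
      (fun i => b.map (θ ≪≫ₗ θ) i * a i) Finset.univ).symm
  refine ⟨⟨fun x y => (isLeftAction_sourceAction hV hu).map_mul _ _,
      fun x => (isLeftAction_sourceAction hV hu).map_star _⟩,
    ⟨fun x y => hM.isRightAction.map_mul _ _, fun x => hM.isRightAction.map_star _⟩, _,
    ⟨n, a.map (opLinearEquiv ℂ), fun i => op (θ (θ (b i))),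
    op (unitElem hV hu), op (unitElem hV hu), _, ?_, hu1, ?_, ?_, hM.isModularSqrt_op, rfl⟩, ?_⟩
  · intro i j
    change counit hV hu (a j * θ (θ (b i))) = _
    rw [hM.counit_mul_modularSqrt, hab i j]
  · rw [hsum]; exact (hu1 _).1
  · rw [hsum]; exact (hu1 _).1
  · rw [domain_proj_eq_sum hab, pairOp, map_sum, map_sum]
    refine Finset.sum_congr rfl fun i _ => ?_
    change _ = TensorProduct.map (sourceMap V ε ((a i * unitElem hV hu : leftSubalgebra hV hu)))
      (targetMap V ε (θ.symm (θ.symm (θ (θ (b i)))) : leftSubalgebra hV hu))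
    rw [(isUnitElem_unitElem hV hu _).2, θ.symm_apply_apply, θ.symm_apply_apply]

end IsModularPair

end MPI

end

/-! ### The pseudo-multiplicative unitary -/

theorem mainTheorem7 {H : Type*} [NormedAddCommGroup H] [InnerProductSpace ℂ H]
    [FiniteDimensional ℂ H] (V : Module.End ℂ (H ⊗[ℂ] H)) (hV : MPI.IsMPI V)
    (ε εhat : Module.Dual ℂ (Module.End ℂ H)) (hunital : MPI.IsUnitalBy V ε εhat) :
    -- the C*-algebra `A^L`, contained in the right leg of `V`, with unit `λ(ε̂) = ρ(ε)`
    ∃ AL : NonUnitalStarSubalgebra ℂ (Module.End ℂ H),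
      (AL : Set (Module.End ℂ H)) = MPI.leftSub V ∧
      (∀ x ∈ AL, ∃ ω, MPI.lam V ω = x) ∧
      MPI.lam V εhat = MPI.rho V ε ∧
      ∃ one : AL, (one : Module.End ℂ H) = MPI.lam V εhat ∧ MPI.IsUnitElem one ∧
      -- the restriction `ν` of `ε` to `A^L`, of index one, and `θ = θ_ν^{1/2}`
      ∃ ν : AL →ₗ[ℂ] ℂ, (∀ x : AL, ν x = ε x) ∧ MPI.IsFaithfulPositive ν ∧ MPI.IsIndex ν one ∧
      ∃ θ : AL ≃ₗ[ℂ] AL, MPI.IsModularSqrt ν θ ∧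
      -- the actions `α₀₁(x) = x`, `α₀₂(x) = S(θ⁻¹(x))`, `α₁₂(x) = x ⇀ ρ(ε)`
      ∃ α₀₁ α₀₂ α₁₂ : AL →ₗ[ℂ] Module.End ℂ H,
        (∀ x : AL, α₀₁ x = x) ∧
        (∀ x : AL, α₀₂ x = MPI.piR V ε (θ.symm x : Module.End ℂ H)) ∧
        (∀ (x : AL) (ω : Module.Dual ℂ (Module.End ℂ H)), MPI.lam V ω = x →
          α₁₂ x = MPI.sliceRight ω (star V * V)) ∧
        α₀₂ one = one ∧ α₁₂ one = one ∧
        -- the restriction `U` of `V` to its initial and final supports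
        ∃ U : LinearMap.range (star V * V) ≃ₗᵢ[ℂ] LinearMap.range (V * star V),
          (∀ ξ : LinearMap.range (star V * V), (U ξ : H ⊗[ℂ] H) = V ξ) ∧
          MPI.IsPseudoMultiplicativeUnitary ν α₀₁ α₀₂ α₁₂ U := by
  obtain ⟨c, g, k, hM⟩ := hunital.exists_isModularPair hV
  have hfaithful : MPI.IsFaithfulPositive (MPI.counit hV hunital) :=
    ⟨fun x => hM.counit_nonneg hV hunital x.2,
      fun x hx => Subtype.ext (hM.counit_faithful hV hunital x.2 hx)⟩
  refine ⟨MPI.leftSubalgebra hV hunital, rfl, fun x hx => hunital.range_right_mem hV hx,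
    hunital.unit_eq hV, MPI.unitElem hV hunital, rfl, MPI.isUnitElem_unitElem hV hunital,
    MPI.counit hV hunital, fun _ => rfl, hfaithful, ?_, hM.modularSqrt hV hunital,
    hM.isModularSqrt, MPI.inclusion hV hunital, hM.rightAction hV hunital,
    MPI.sourceAction hV hunital, fun _ => rfl, fun x => ?_, fun x ω h => ?_, ?_, ?_, hV.restrict,
    fun _ => rfl, ?_⟩
  · obtain ⟨n, a, b, hab⟩ := MPI.exists_dual_bases hV hunital
    exact ⟨n, a, b, hab, (MPI.sum_mul_eq_unitElem hab).symm⟩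
  · exact (hunital.piR_eq_targetMap hV (hunital.range_right_mem hV
      ((hM.modularSqrt hV hunital).symm x).2)).symm
  · exact (hunital.sliceR_domain_eq_sourceMap ω hV h).symm
  · change MPI.targetMap V ε (k * MPI.sliceL εhat V * g) = MPI.sliceL εhat V
    rw [hunital.rightLeg_mul_unit (hunital.range_right_mem hV hM.k_mem), hM.k_mul_g,
      hunital.targetMap_unit, hunital.unit_eq hV]
  · exact hunital.sourceMap_unit.trans (hunital.unit_eq hV).symm
  · exact
    { faithful_positive := hfaithful
      left_β := MPI.isLeftAction_inclusion hV hunital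
      right_α := hM.isRightAction
      left_βhat := MPI.isLeftAction_sourceAction hV hunital
      injective_β := Subtype.val_injective
      injective_α := by
        rw [injective_iff_map_eq_zero]
        intro x hx
        have h := hunital.eq_zero_of_targetMap hV ((hM.modularSqrt hV hunital).symm x).2 hx
        exact (hM.modularSqrt hV hunital).symm.map_eq_zero_iff.1 (Subtype.ext h)
      injective_βhat := by
        rw [injective_iff_map_eq_zero]
        exact fun x hx => Subtype.ext (hunital.eq_zero_of_sourceMap hV x.2 hx)
      commute_α_β := fun x y => (hV.commute_right_left y.2 (hM.rightAction_mem x)).symm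
      commute_α_βhat := fun x y =>
        hunital.commute_left_domain hV (hM.rightAction_mem x) (hunital.sourceMap_mem hV y.2)
      commute_β_βhat := fun x y =>
        hV.commute_right_domain x.2 (hunital.sourceMap_mem hV y.2)
      target := hM.isRelTensorProj_range
      source := hM.isRelTensorProj_domain
      intertwines₀₁ := hV.intertwines
        (fun x => (hV.commute_rTensor_star x.2).mul_right (hV.commute_rTensor x.2))
        (fun x => (hV.commute_rTensor x.2).eq.symm)
      intertwines₁₂ := hV.intertwines
        (fun x => MPI.commute_lTensor_iff.2 fun c hc =>
          hV.commute_right_left x.2 (hunital.rightLeg_domain hV ▸ hc))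
        (fun x => hunital.mul_lTensor_right hV x.2)
      intertwines₂₃ := hV.intertwines
        (fun x => (hV.commute_lTensor_star (hunital.sourceMap_mem hV x.2)).mul_right
          (hV.commute_lTensor (hunital.sourceMap_mem hV x.2)))
        (fun x => (hV.commute_lTensor (hunital.sourceMap_mem hV x.2)).eq.symm)
      intertwines₀₃ := hV.intertwines
        (fun x => MPI.commute_rTensor_iff.2 fun d hd =>
          hunital.commute_left_domain hV (hM.rightAction_mem x) hd)
        (fun x => hunital.mul_rTensor_left hV (hM.rightAction_mem x))
      pentagon := hunital.pentagonDiagram hV }
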